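/- Let $n\ge 1$ and let $D\subseteq\mathbb{C}^n$ be a reduced divisor, given by a global holomorphic equation $f$ which generates its ideal sheaf. A holomorphic vector field $\delta$ is logarithmic along $D$, $\delta\in\operatorname{Der}(-\log D)$, if $\delta(f)\in\mathcal{O}\cdot f$. Suppose that $D$ is a linear free divisor: the sheaf $\operatorname{Der}(-\log D)$ is locally free, and the $\Gamma(\mathbb{C}^n,\mathcal{O})$-module $\Gamma(\mathbb{C}^n,\operatorname{Der}(-\log D))$ has a basis $\delta_1,\dots,\delta_n$ of vector fields of degree $0$, that is, of the form $\sum_{i,j}x_ia_{ij}\partial_j$ with $a_{ij}\in\mathbb{C}$. Fix such a basis, called a global degree-$0$ basis, and put $\Delta=\det(\delta_i(x_j))_{i,j}$. Identify $\sum_{i,j}x_ia_{ij}\partial_j$ with the matrix $(a_{ij})$, so that the Lie bracket becomes the commutator; for a matrix $\delta$ let $\delta_S$ be the semisimple part of its Jordan decomposition. Let $\chi=\sum_i x_i\partial_i$, and let $s+1$ be the maximal number of linearly independent logarithmic vector fields which are diagonal in a common system of linear coordinates. Then there is a global degree-$0$ basis $\chi,\sigma_1,\dots,\sigma_s,\nu_1,\dots,\nu_{n-s-1}$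 of $\operatorname{Der}(-\log D)$ such that: 1. $[\chi,\sigma_i]=0$ and $[\chi,\nu_j]=0$ for all $i,j$; 2. the $\sigma_i$ are simultaneously diagonalizable with eigenvalues in $\mathbb{Q}$, and $\sigma_i(\Delta)=0$; 3. the $\nu_j$ are nilpotent, and $\nu_j(\Delta)=0$; 4. there are $q_{ij}\in\mathbb{Q}$ with $[\sigma_i,\nu_j]=q_{ij}\nu_j$ for all $i,j$, and $\sum_j q_{ij}+\operatorname{tr}(\sigma_i)=0$ for every $i$; 5. if $\delta$ is a logarithmic vector field of degree $0$ with $[\sigma_i,\delta]=0$ for $i=1,\dots,s$, then $\delta_S\in\langle\chi,\sigma_1,\dots,\sigma_s\rangle_{\mathbb{C}}$; if moreover $\delta(\Delta)=0$, then $\delta_S\in\langle\sigma_1,\dots,\sigma_s\rangle_{\mathbb{C}}$. Moreover, $s\ge 1$ if $n\ge 2$; and if $s=n-1$, then there are linear coordinates $y_1,\dots,y_n$ on $\mathbb{C}^n$ with $\Delta=y_1\cdots y_n$ and $D=\{y_1\cdots y_n=0\}$, so $D$ is a normal crossing divisor. -/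

import Mathlib

namespace LFD

/-- A divisor `D ⊆ ℂⁿ` is given by a global holomorphic equation `f`, not identically zero, with
`D = {f = 0}`. It is reduced when `f` generates the ideal sheaf of its zero set: every holomorphic
function on an open set `U` that vanishes on `D ∩ U` is a multiple of `f` on `U`. -/
structure IsReducedEquation {n : ℕ} (f : (Fin n → ℂ) → ℂ) : Prop where
  holomorphic : AnalyticOnNhd ℂ f Set.univ
  ne_zero : ∃ x, f x ≠ 0
  reduced : ∀ (U : Set (Fin n → ℂ)) (g : (Fin n → ℂ) → ℂ), IsOpen U → AnalyticOnNhd ℂ g U →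
    (∀ x ∈ U, f x = 0 → g x = 0) →
      ∃ q : (Fin n → ℂ) → ℂ, AnalyticOnNhd ℂ q U ∧ ∀ x ∈ U, g x = q x * f x

/-- The action `v(g) = ∑ⱼ vⱼ ∂ⱼ g` of a vector field `v = ∑ⱼ vⱼ ∂ⱼ` on a function `g`. -/
noncomputable def act {n : ℕ} (v : (Fin n → ℂ) → (Fin n → ℂ)) (g : (Fin n → ℂ) → ℂ) :
    (Fin n → ℂ) → ℂ :=
  fun x => fderiv ℂ g x (v x)

/-- `v` is a section over `U` of `Der(-log D)`, where `D = {f = 0}`: it is holomorphic on `U` and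
`v(f) ∈ 𝒪(U) · f`. -/
def IsLogarithmic {n : ℕ} (f : (Fin n → ℂ) → ℂ) (U : Set (Fin n → ℂ))
    (v : (Fin n → ℂ) → (Fin n → ℂ)) : Prop :=
  AnalyticOnNhd ℂ v U ∧
    ∃ g : (Fin n → ℂ) → ℂ, AnalyticOnNhd ℂ g U ∧ ∀ x ∈ U, act v f x = g x * f x

/-- The family `η` is a basis of the `𝒪(U)`-module `Γ(U, Der(-log D))`, where `D = {f = 0}`: its
members are sections, and each section is a combination of them with holomorphic coefficients,
which are unique as functions on `U`. -/
def IsLogBasis {n : ℕ} {ι : Type} [Fintype ι] (f : (Fin n → ℂ) → ℂ) (U : Set (Fin n → ℂ))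
    (η : ι → (Fin n → ℂ) → (Fin n → ℂ)) : Prop :=
  (∀ i, IsLogarithmic f U (η i)) ∧
  (∀ v, IsLogarithmic f U v → ∃ h : ι → (Fin n → ℂ) → ℂ,
    (∀ i, AnalyticOnNhd ℂ (h i) U) ∧ ∀ x ∈ U, v x = ∑ i, h i x • η i x) ∧
  (∀ h h' : ι → (Fin n → ℂ) → ℂ,
    (∀ i, AnalyticOnNhd ℂ (h i) U) → (∀ i, AnalyticOnNhd ℂ (h' i) U) →
    (∀ x ∈ U, ∑ i, h i x • η i x = ∑ i, h' i x • η i x) →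
      ∀ i, ∀ x ∈ U, h i x = h' i x)

/-- The divisor `D = {f = 0}` is free: the sheaf `Der(-log D)` is locally free (of finite rank). -/
def IsFree {n : ℕ} (f : (Fin n → ℂ) → ℂ) : Prop :=
  ∀ p : Fin n → ℂ, ∃ U : Set (Fin n → ℂ), IsOpen U ∧ p ∈ U ∧
    ∃ (r : ℕ) (η : Fin r → (Fin n → ℂ) → (Fin n → ℂ)),
      ∀ V : Set (Fin n → ℂ), IsOpen V → V ⊆ U → IsLogBasis f V η

/-- The vector field of degree `0` with matrix `A`, namely `∑ᵢⱼ xᵢ aᵢⱼ ∂ⱼ`. -/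
def lin {n : ℕ} (A : Matrix (Fin n) (Fin n) ℂ) : (Fin n → ℂ) → (Fin n → ℂ) :=
  fun x => Matrix.vecMul x A

/-- The Lie bracket of vector fields of degree `0` corresponds to the commutator of matrices. -/
theorem lieBracket_lin {n : ℕ} (A B : Matrix (Fin n) (Fin n) ℂ) :
    VectorField.lieBracket ℂ (lin A) (lin B) = lin ⁅A, B⁆ := by
  have key : ∀ (C : Matrix (Fin n) (Fin n) ℂ) (x y : Fin n → ℂ),
      fderiv ℂ (lin C) x y = Matrix.vecMul y C := by
    intro C x y
    have h : lin C = ⇑(LinearMap.toContinuousLinearMap (Matrix.vecMulLinear C)) := rfl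
    rw [h, ContinuousLinearMap.fderiv]
    rfl
  funext x
  simp only [VectorField.lieBracket, key, lin, Ring.lie_def, Matrix.vecMul_sub,
    Matrix.vecMul_vecMul]

/-- The reduced divisor `{f = 0}` is a linear free divisor: it is free, and the module of its
global logarithmic vector fields has a basis `δ₁, …, δₙ` of vector fields of degree `0`. -/
def IsLinearFree {n : ℕ} (f : (Fin n → ℂ) → ℂ) : Prop :=
  IsReducedEquation f ∧ IsFree f ∧
    ∃ δ : Fin n → Matrix (Fin n) (Fin n) ℂ, IsLogBasis f Set.univ (fun i => lin (δ i))

/-- The function `Δ = det (δᵢ(xⱼ))` of vector fields `δ₁, …, δₙ` of degree `0`. -/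
noncomputable def discr {n : ℕ} (δ : Fin n → Matrix (Fin n) (Fin n) ℂ) : (Fin n → ℂ) → ℂ :=
  fun x => (Matrix.of fun i j => lin (δ i) x j).det

/-- The numbers `r` such that, in some linear coordinates, there are `r` linearly independent
diagonal vector fields that are logarithmic along `D = {f = 0}`. -/
def diagonalRanks {n : ℕ} (f : (Fin n → ℂ) → ℂ) : Set ℕ :=
  {r | ∃ P : Matrix (Fin n) (Fin n) ℂ, IsUnit P.det ∧ ∃ d : Fin r → Fin n → ℂ,
    LinearIndependent ℂ d ∧
      ∀ k, IsLogarithmic f Set.univ (lin (P * Matrix.diagonal (d k) * P⁻¹))}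

/-- `A = S + N` is the decomposition of `A` into its semisimple part `S` and its nilpotent
part `N`. -/
structure IsJordanDecomposition {n : ℕ} (A S N : Matrix (Fin n) (Fin n) ℂ) : Prop where
  eq_add : A = S + N
  commute : Commute S N
  semisimple : Module.End.IsSemisimple (Matrix.toLin' S)
  nilpotent : IsNilpotent N

end LFD

/-!
Since `{f = 0} = {Δ = 0}`, the logarithmic vector fields of degree `0` form the Lie algebra of
matrices `A` with `A(Δ) ∈ ℂ Δ`, and it splits as the line of the Euler field plus the annihilator
of `Δ`. In coordinates that diagonalize a maximal torus, a diagonal field annihilates `Δ` if and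
only if its eigenvalues satisfy integral linear equations, one for each monomial of `Δ`; so this
part of the torus has a basis `σ` with rational eigenvalues. The algebra is spanned by joint
eigenvectors of `ad σ`. Those of non-zero weight are nilpotent. Those of weight zero have Jordan
parts that are again logarithmic: the semisimple part lies in the torus by maximality, and the
nilpotent part annihilates `Δ`. The trace identity comes from applying `σᵢ` to the determinant of
the Saito matrix of the resulting basis.

If `s = 0`, the annihilator of `Δ` consists of nilpotent matrices, so by Engel's theorem two linear
forms `l₁, l₂` satisfy `A(l₁) = 0` and `A(l₂) ∈ ℂ l₁` for all `A` in it. Expanding the logarithmic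
field `f ∂` in the basis, for a constant field `∂` dual to `l₁`, then gives `f = k l₁` where `k`
vanishes on `{l₁ = 0}`, against reducedness. If `s = n - 1`, all the fields are diagonal, and `Δ`
is a product of coordinates.
-/

namespace LFD

open MvPolynomial Matrix Filter Topology

section LinearDerivation

variable {R ι : Type*} [CommRing R] [Fintype ι]

/-- The derivation `∑ᵢⱼ xᵢ aᵢⱼ ∂ⱼ` of the polynomial ring: the algebraic form of the vector field of
degree `0` with matrix `A`. -/
noncomputable def linDer :
    Matrix ι ι R →ₗ[R] Derivation R (MvPolynomial ι R) (MvPolynomial ι R) where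
  toFun A := mkDerivation R fun j => ∑ i, A i j • X i
  map_add' A B := derivation_ext fun j => by simp [add_smul, Finset.sum_add_distrib]
  map_smul' c A := derivation_ext fun j => by simp [mul_smul, Finset.smul_sum]

@[simp] theorem linDer_X (A : Matrix ι ι R) (j : ι) : linDer A (X j) = ∑ i, A i j • X i :=
  mkDerivation_X _ _ _

theorem linDer_linDer_X (A B : Matrix ι ι R) (j : ι) :
    linDer A (linDer B (X j)) = ∑ i, (A * B) i j • X i := by
  simp only [linDer_X, map_sum, Derivation.map_smul, Finset.smul_sum, smul_smul, mul_apply,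
    Finset.sum_smul]
  rw [Finset.sum_comm]
  simp only [mul_comm]

theorem linDer_lie (A B : Matrix ι ι R) : linDer ⁅A, B⁆ = ⁅linDer A, linDer B⁆ :=
  derivation_ext fun j => by
    rw [Derivation.commutator_apply, linDer_linDer_X, linDer_linDer_X, linDer_X, Ring.lie_def,
      ← Finset.sum_sub_distrib]
    simp only [Matrix.sub_apply, sub_smul]

theorem commute_linDer {A B : Matrix ι ι R} (h : Commute A B) :
    Commute (linDer A : Module.End R (MvPolynomial ι R)) (linDer B) :=
  LinearMap.ext fun p => sub_eq_zero.mp <| by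
    simpa [Ring.lie_def, h.eq, Derivation.commutator_apply] using
      (DFunLike.congr_fun (linDer_lie A B) p).symm

theorem linDer_apply (A : Matrix ι ι R) (p : MvPolynomial ι R) :
    linDer A p = ∑ j, (∑ i, A i j • X i) * pderiv j p := by
  classical
  have h : linDer A = ∑ j, (∑ i, A i j • X (R := R) i) • pderiv j := by
    refine derivation_ext fun j => ?_
    rw [linDer_X, ← Derivation.coeFnAddMonoidHom_apply (∑ j, _), map_sum, Finset.sum_apply]
    simp [pderiv_X, Pi.single_apply]
  rw [h, ← Derivation.coeFnAddMonoidHom_apply, map_sum, Finset.sum_apply]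
  simp

/-- The substitution `xₖ ↦ ∑ᵢ xᵢ pᵢₖ`, that is, the linear change of coordinates with matrix `P`. -/
noncomputable def subst (P : Matrix ι ι R) : MvPolynomial ι R →ₐ[R] MvPolynomial ι R :=
  aeval fun k => ∑ i, P i k • X i

@[simp] theorem subst_X (P : Matrix ι ι R) (k : ι) : subst P (X k) = ∑ i, P i k • X i :=
  aeval_X _ _

theorem subst_mul (P Q : Matrix ι ι R) : subst (P * Q) = (subst P).comp (subst Q) :=
  algHom_ext fun j => by
    simp only [AlgHom.comp_apply, subst_X, map_sum, map_smul, Finset.smul_sum, smul_smul,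
      mul_apply, Finset.sum_smul]
    rw [Finset.sum_comm]
    simp only [mul_comm]

theorem subst_one [DecidableEq ι] : subst (1 : Matrix ι ι R) = AlgHom.id R _ :=
  algHom_ext fun j => by simp [one_apply]

theorem subst_injective [DecidableEq ι] (P : (Matrix ι ι R)ˣ) :
    Function.Injective (subst (P : Matrix ι ι R)) :=
  Function.LeftInverse.injective (g := subst (↑P⁻¹ : Matrix ι ι R)) fun p => by
    rw [← AlgHom.comp_apply, ← subst_mul, Units.inv_mul, subst_one, AlgHom.id_apply]

theorem linDer_subst {A B P : Matrix ι ι R} (h : A * P = P * B) (p : MvPolynomial ι R) :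
    linDer A (subst P p) = subst P (linDer B p) := by
  have hX (j : ι) : linDer A (subst P (X j)) = subst P (linDer B (X j)) := by
    have h' := linDer_linDer_X A P j
    have h'' := DFunLike.congr_fun (subst_mul P B) (X j)
    rw [h] at h'
    simp_all
  induction p using MvPolynomial.induction_on with
  | C a => simp [← algebraMap_eq]
  | add p q hp hq => simp only [map_add, hp, hq]
  | mul_X p j hp => simp only [map_mul, Derivation.leibniz, map_add, smul_eq_mul, hp, hX]

/-- The elements annihilated by some power of the derivation `D`. -/
def nilSubalgebra {A : Type*} [CommRing A] [Algebra R A] (D : Derivation R A A) :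
    Subalgebra R A where
  carrier := {a | ∃ k, ((D : Module.End R A) ^ k) a = 0}
  add_mem' := by
    rintro a b ⟨k, hk⟩ ⟨l, hl⟩
    have ha : ((D : Module.End R A) ^ (k + l)) a = 0 := by
      rw [add_comm, pow_add, Module.End.mul_apply, hk, map_zero]
    have hb : ((D : Module.End R A) ^ (k + l)) b = 0 := by
      rw [pow_add, Module.End.mul_apply, hl, map_zero]
    exact ⟨k + l, by rw [map_add, ha, hb, add_zero]⟩
  mul_mem' := by
    rintro a b ⟨k, hk⟩ ⟨l, hl⟩
    refine ⟨k + l, ?_⟩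
    induction hm : k + l generalizing k l a b with
    | zero =>
      obtain ⟨rfl, rfl⟩ : k = 0 ∧ l = 0 := by lia
      simp_all
    | succ m ih =>
      obtain _ | k := k
      · simp_all
      obtain _ | l := l
      · simp_all
      rw [pow_succ, Module.End.mul_apply, Derivation.coeFn_coe, Derivation.leibniz, map_add,
        smul_eq_mul, smul_eq_mul, ih (k + 1) hk l (by rwa [pow_succ] at hl) (by lia),
        ih (l + 1) hl k (by rwa [pow_succ] at hk) (by lia), add_zero]
  algebraMap_mem' r := ⟨1, by simp⟩

theorem nilSubalgebra_linDer_eq_top [DecidableEq ι] {N : Matrix ι ι R} (hN : IsNilpotent N) :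
    nilSubalgebra (linDer N) = ⊤ := by
  obtain ⟨k, hk⟩ := hN
  rw [eq_top_iff, ← adjoin_range_X, Algebra.adjoin_le_iff]
  rintro _ ⟨j, rfl⟩
  have hX (m : ℕ) : ((linDer N : Module.End R (MvPolynomial ι R)) ^ m) (X j) =
      ∑ i, (N ^ m) i j • X i := by
    induction m with
    | zero => simp [one_apply]
    | succ m ih =>
      rw [pow_succ', Module.End.mul_apply, ih, pow_succ', ← linDer_linDer_X, linDer_X,
        Derivation.coeFn_coe]
  exact ⟨k, by simp [hX, hk]⟩

end LinearDerivation

section Torus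

/-- The diagonal matrices in the linear coordinates given by `P`: the map `d ↦ P diag(d) P⁻¹`. -/
def diagConj {R ι : Type*} [CommRing R] [Fintype ι] [DecidableEq ι] (P : (Matrix ι ι R)ˣ) :
    (ι → R) →ₐ[R] Matrix ι ι R :=
  (MulSemiringAction.toAlgHom R (Matrix ι ι R) (ConjAct.toConjAct P)).comp (diagonalAlgHom R)

variable {R ι : Type*} [CommRing R] [Fintype ι] [DecidableEq ι] (P : (Matrix ι ι R)ˣ)

theorem diagConj_apply (d : ι → R) : diagConj P d = P * diagonal d * (↑P⁻¹ : Matrix ι ι R) := rfl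

theorem diagConj_injective : Function.Injective (diagConj P) := fun _ _ h =>
  diagonal_injective ((Units.mul_right_inj P).mp ((Units.mul_left_inj P⁻¹).mp h))

theorem commute_diagConj (d d' : ι → R) : Commute (diagConj P d) (diagConj P d') :=
  (Commute.all d d').map (diagConj P)

theorem coeff_linDer_diagonal (d : ι → R) (p : MvPolynomial ι R) (α : ι →₀ ℕ) :
    coeff α (linDer (diagonal d) p) = Finsupp.weight d α * coeff α p := by
  induction p using MvPolynomial.induction_on' with
  | add p q hp hq => simp only [map_add, coeff_add, hp, hq, mul_add]
  | monomial β a =>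
    have h : linDer (diagonal d) (monomial β a) = Finsupp.weight d β • monomial β a := by
      simp [linDer_apply, diagonal_apply, X_mul_pderiv_monomial, Finsupp.weight_apply,
        Finsupp.sum_fintype, Finset.sum_smul, smul_comm (d _), -pderiv_monomial,
        -nsmul_eq_mul]
    rw [h, coeff_smul, coeff_monomial]
    split_ifs with hβ
    · rw [hβ, smul_eq_mul]
    · rw [smul_zero, mul_zero]

variable {P}

theorem coeff_subst_linDer_diagConj (d : ι → R) (p : MvPolynomial ι R) (α : ι →₀ ℕ) :
    coeff α (subst ↑P⁻¹ (linDer (diagConj P d) p)) =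
      Finsupp.weight d α * coeff α (subst ↑P⁻¹ p) := by
  rw [← coeff_linDer_diagonal, linDer_subst (B := diagConj P d)]
  simp [diagConj_apply, ← mul_assoc]

variable [IsDomain R]

theorem linDer_diagConj_eq_smul_iff {d : ι → R} {p : MvPolynomial ι R} {c : R} :
    linDer (diagConj P d) p = c • p ↔ IsWeightedHomogeneous d (subst ↑P⁻¹ p) c := by
  rw [← (subst_injective P⁻¹).eq_iff, MvPolynomial.ext_iff]
  refine forall_congr' fun α => ?_
  rw [coeff_subst_linDer_diagConj, map_smul, coeff_smul, smul_eq_mul, mul_eq_mul_right_iff,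
    ← or_iff_not_imp_right]

theorem linDer_diagConj_eq_smul_of_pow {d : ι → R} {p : MvPolynomial ι R} {c : R} {k : ℕ}
    (h : (((linDer (diagConj P d) : Module.End R (MvPolynomial ι R)) - c • 1) ^ k) p = 0) :
    linDer (diagConj P d) p = c • p := by
  set T : Module.End R (MvPolynomial ι R) := linDer (diagConj P d) - c • 1
  have hcoeff (α : ι →₀ ℕ) (q : MvPolynomial ι R) : coeff α (subst ↑P⁻¹ (T q)) =
      (Finsupp.weight d α - c) * coeff α (subst ↑P⁻¹ q) := by
    simp [T, -coe_units_inv, coeff_subst_linDer_diagConj, sub_mul]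
  have hpow (α : ι →₀ ℕ) : (Finsupp.weight d α - c) ^ k * coeff α (subst ↑P⁻¹ p) = 0 := by
    suffices coeff α (subst ↑P⁻¹ ((T ^ k) p)) =
        (Finsupp.weight d α - c) ^ k * coeff α (subst ↑P⁻¹ p) by rw [← this, h]; simp
    clear h
    induction k with
    | zero => simp
    | succ k ih => rw [pow_succ', Module.End.mul_apply, hcoeff, ih, pow_succ', mul_assoc]
  rw [linDer_diagConj_eq_smul_iff]
  intro α hα
  exact sub_eq_zero.mp (eq_zero_of_pow_eq_zero ((mul_eq_zero.mp (hpow α)).resolve_right hα))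

end Torus

theorem pow_apply_eq_pow_apply_of_commute {R M : Type*} [Semiring R] [AddCommMonoid M] [Module R M]
    {T E : Module.End R M} (h : Commute T E) {v : M} (hv : T v = E v) (k : ℕ) :
    (T ^ k) v = (E ^ k) v := by
  induction k with
  | zero => rfl
  | succ k ih =>
    rw [pow_succ', Module.End.mul_apply, ih, ← Module.End.mul_apply, (h.pow_right k).eq,
      Module.End.mul_apply, hv, ← Module.End.mul_apply, pow_succ]

/-- `p` is annihilated by a power of `linDer N`, hence is a generalized eigenvector of the
diagonalizable part, whose generalized eigenvectors are eigenvectors. -/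
theorem linDer_eq_smul_of_diagConj_add {R ι : Type*} [CommRing R] [IsDomain R] [Fintype ι]
    [DecidableEq ι] {P : (Matrix ι ι R)ˣ} {d : ι → R} {N : Matrix ι ι R} (hN : IsNilpotent N)
    (hdN : Commute (diagConj P d) N) {c : R} {p : MvPolynomial ι R}
    (h : linDer (diagConj P d + N) p = c • p) : linDer (diagConj P d) p = c • p := by
  obtain ⟨k, hk⟩ : p ∈ nilSubalgebra (linDer (-N)) :=
    nilSubalgebra_linDer_eq_top hN.neg ▸ Algebra.mem_top
  refine linDer_diagConj_eq_smul_of_pow (k := k) ?_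
  have hcomm : Commute ((linDer (diagConj P d) : Module.End R (MvPolynomial ι R)) - c • 1)
      (linDer (-N)) :=
    (commute_linDer hdN.neg_right).sub_left ((Commute.one_left _).smul_left c)
  rw [map_add] at h
  rw [pow_apply_eq_pow_apply_of_commute hcomm, hk]
  simp [← h]

section Saito

variable {R ι : Type*} [CommRing R] [Fintype ι]

/-- The first order Taylor expansion `a ↦ a + ε D(a)` along a derivation `D`. -/
def taylorHom {A : Type*} [CommRing A] [Algebra R A] (D : Derivation R A A) :
    A →+* DualNumber A where
  toFun a := TrivSqZeroExt.inl a + TrivSqZeroExt.inr (D a)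
  map_one' := by simp
  map_mul' a b := by ext <;> simp [mul_comm]
  map_zero' := by simp
  map_add' a b := by ext <;> simp

theorem derivation_det [DecidableEq ι] {A : Type*} [CommRing A] [Algebra R A] (D : Derivation R A A)
    {M B C : Matrix ι ι A} (h : M.map D = B * M + M * C) :
    D M.det = (B.trace + C.trace) * M.det := by
  let ε : DualNumber A := DualNumber.eps
  let φ := TrivSqZeroExt.inlHom A A
  have hε : ε * ε = 0 := DualNumber.eps_mul_eps
  have hdet (N : Matrix ι ι A) :
      (1 + ε • φ.mapMatrix N).det = 1 + φ N.trace * ε := by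
    rw [det_one_add_smul, pow_two, hε, mul_zero, add_zero]
    simp [Matrix.trace]
  have hM : (taylorHom D).mapMatrix M =
      (1 + ε • φ.mapMatrix B) * φ.mapMatrix M * (1 + ε • φ.mapMatrix C) := by
    have h1 : (taylorHom D).mapMatrix M = φ.mapMatrix M + ε • φ.mapMatrix (M.map D) := by
      ext i j <;> simp [taylorHom, ε, φ]
    rw [h1, h, map_add, map_mul, map_mul]
    simp only [add_mul, mul_add, one_mul, mul_one, smul_mul_assoc, mul_smul_comm, smul_smul, hε,
      zero_smul, add_zero, smul_add, add_assoc]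
  calc D M.det = TrivSqZeroExt.snd (taylorHom D M.det) := by simp [taylorHom]
    _ = TrivSqZeroExt.snd ((1 + φ B.trace * ε) * φ M.det * (1 + φ C.trace * ε)) := by
      rw [RingHom.map_det, hM, det_mul, det_mul, hdet, hdet, ← RingHom.map_det]
    _ = B.trace * M.det + M.det * C.trace := by simp [φ, ε, add_comm]
    _ = (B.trace + C.trace) * M.det := by ring

/-- The Saito matrix `(δᵢ(xⱼ))` of vector fields `δᵢ` of degree `0`. -/
noncomputable def saitoMatrix (δ : ι → Matrix ι ι R) : Matrix ι ι (MvPolynomial ι R) :=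
  Matrix.of fun i j => linDer (δ i) (X j)

/-- The determinant of the Saito matrix, that is, `Δ` as a polynomial. -/
noncomputable def discrPoly [DecidableEq ι] (δ : ι → Matrix ι ι R) : MvPolynomial ι R :=
  (saitoMatrix δ).det

variable {δ : ι → Matrix ι ι R} {A C : Matrix ι ι R}

theorem map_linDer_saitoMatrix (h : ∀ i, ⁅A, δ i⁆ = ∑ k, C i k • δ k) :
    (saitoMatrix δ).map (linDer A) =
      C.map MvPolynomial.C * saitoMatrix δ + saitoMatrix δ * A.map MvPolynomial.C := by
  refine Matrix.ext fun i j => ?_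
  have hbr : linDer A (linDer (δ i) (X j)) =
      linDer ⁅A, δ i⁆ (X j) + linDer (δ i) (linDer A (X j)) := by
    rw [linDer_lie, Derivation.commutator_apply, sub_add_cancel]
  have hC : linDer (∑ k, C i k • δ k) (X j) = ∑ k, C i k • linDer (δ k) (X j) := by
    simp only [map_sum, map_smul]
    rw [← Derivation.coeFnAddMonoidHom_apply, map_sum, Finset.sum_apply]
    rfl
  simp only [saitoMatrix, map_apply, of_apply, Matrix.add_apply, mul_apply]
  rw [hbr, h, hC, linDer_X A, map_sum]
  simp only [Derivation.map_smul]
  simp only [smul_eq_C_mul, mul_comm]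

variable [DecidableEq ι]

theorem linDer_discrPoly (h : ∀ i, ⁅A, δ i⁆ = ∑ k, C i k • δ k) :
    linDer A (discrPoly δ) = (C.trace + A.trace) • discrPoly δ := by
  rw [discrPoly, derivation_det _ (map_linDer_saitoMatrix h), smul_eq_C_mul, map_add]
  simp [Matrix.trace]

theorem linDer_one_discrPoly (δ : ι → Matrix ι ι R) :
    linDer 1 (discrPoly δ) = (Fintype.card ι : R) • discrPoly δ := by
  have h := linDer_discrPoly (δ := δ) (A := 1) (C := 0) fun i => by simp [Ring.lie_def]
  rwa [trace_zero, zero_add, trace_one] at h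

end Saito

section Evaluation

variable {n : ℕ}

theorem eval_linDer_X (A : Matrix (Fin n) (Fin n) ℂ) (x : Fin n → ℂ) (j : Fin n) :
    eval x (linDer A (X j)) = lin A x j := by
  simp [lin, vecMul, dotProduct, mul_comm, smul_eval]

theorem eval_discrPoly (δ : Fin n → Matrix (Fin n) (Fin n) ℂ) (x : Fin n → ℂ) :
    eval x (discrPoly δ) = discr δ x := by
  rw [discrPoly, RingHom.map_det, discr]
  congr 1
  ext i j
  simp only [saitoMatrix, RingHom.mapMatrix_apply, map_apply, of_apply, eval_linDer_X]

theorem hasFDerivAt_eval (p : MvPolynomial (Fin n) ℂ) (x : Fin n → ℂ) :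
    ∃ p' : (Fin n → ℂ) →L[ℂ] ℂ, HasFDerivAt (fun y => eval y p) p' x ∧
      ∀ A : Matrix (Fin n) (Fin n) ℂ, p' (lin A x) = eval x (linDer A p) := by
  induction p using MvPolynomial.induction_on with
  | C a => exact ⟨0, by simpa using hasFDerivAt_const a x, fun A => by simp [← algebraMap_eq]⟩
  | add p q hp hq =>
    obtain ⟨p', hp, hp'⟩ := hp
    obtain ⟨q', hq, hq'⟩ := hq
    exact ⟨p' + q', by simpa using! hp.add hq, fun A => by simp [hp', hq']⟩
  | mul_X p j hp =>
    obtain ⟨p', hp, hp'⟩ := hp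
    refine ⟨_, by simpa using! hp.mul (hasFDerivAt_apply (𝕜 := ℂ) j x), fun A => ?_⟩
    simp only [Derivation.leibniz, _root_.add_apply, _root_.smul_apply,
      ContinuousLinearMap.proj_apply, hp', smul_eq_mul, map_add, map_mul, eval_X, eval_linDer_X]

theorem act_lin_eval (A : Matrix (Fin n) (Fin n) ℂ) (p : MvPolynomial (Fin n) ℂ) :
    act (lin A) (fun y => eval y p) = fun x => eval x (linDer A p) := by
  funext x
  obtain ⟨p', h, h'⟩ := hasFDerivAt_eval p x
  rw [act, h.fderiv, h']

theorem act_lin_discr_eq_zero_iff (δ : Fin n → Matrix (Fin n) (Fin n) ℂ)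
    (A : Matrix (Fin n) (Fin n) ℂ) :
    (∀ x, act (lin A) (discr δ) x = 0) ↔ linDer A (discrPoly δ) = 0 := by
  simp only [← funext (eval_discrPoly δ), act_lin_eval]
  exact ⟨fun h => MvPolynomial.funext fun x => by simpa using h x, fun h x => by simp [h]⟩

end Evaluation

section Semisimple

variable {K : Type*} [Field K]

theorem isSemisimple_algHom_pi {ι V : Type*} [Finite ι] [AddCommGroup V] [Module K V]
    (ψ : (ι → K) →ₐ[K] Module.End K V) (d : ι → K) : (ψ d).IsSemisimple := by
  have := Fintype.ofFinite ι
  classical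
  refine Module.End.isSemisimple_of_squarefree_aeval_eq_zero
    (p := ∏ c ∈ Finset.univ.image d, (Polynomial.X - Polynomial.C c))
    (Polynomial.separable_prod_X_sub_C_iff'.mpr fun x _ y _ h => h).squarefree ?_
  rw [Polynomial.aeval_algHom_apply]
  convert map_zero ψ
  ext k
  rw [map_prod, Finset.prod_apply]
  exact Finset.prod_eq_zero (Finset.mem_image_of_mem d (Finset.mem_univ k)) (by simp)

attribute [local instance] LieRing.ofAssociativeRing

theorem commute_ad {A : Type*} [Ring A] [Algebra K A] {x y : A} (h : Commute x y) :
    Commute (LieAlgebra.ad K A x) (LieAlgebra.ad K A y) := by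
  rw [commute_iff_lie_eq, ← LieHom.map_lie, commute_iff_lie_eq.mp h, map_zero]

theorem isSemisimple_ad_algHom_pi [PerfectField K] {ι A : Type*} [Finite ι] [Ring A]
    [Algebra K A] [FiniteDimensional K A] (ψ : (ι → K) →ₐ[K] A) (d : ι → K) :
    (LieAlgebra.ad K A (ψ d)).IsSemisimple := by
  have hleft := isSemisimple_algHom_pi ((Algebra.lmul K A).comp ψ) d
  have hright := isSemisimple_algHom_pi
    (AlgHom.ofLinearMap ((LinearMap.mul K A).flip.comp ψ.toLinearMap)
      (by ext; simp) fun d e => by ext; simp [mul_comm d e, mul_assoc]) d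
  rw [LieAlgebra.ad_eq_lmul_left_sub_lmul_right]
  exact hleft.sub_of_commute (LinearMap.ext fun a => by simp [mul_assoc]) hright

variable {ι : Type*} [Fintype ι] [DecidableEq ι]

theorem isSemisimple_toLin'_diagConj (P : (Matrix ι ι K)ˣ) (d : ι → K) :
    Module.End.IsSemisimple (toLin' (diagConj P d)) :=
  isSemisimple_algHom_pi ((toLinAlgEquiv' : Matrix ι ι K ≃ₐ[K] _).toAlgHom.comp (diagConj P)) d

theorem le_span_joint_eigenvectors [IsAlgClosed K] {V κ : Type*} [AddCommGroup V] [Module K V]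
    [FiniteDimensional K V] (F : κ → Module.End K V) (hF : ∀ i, (F i).IsSemisimple)
    (hc : ∀ i j, Commute (F i) (F j)) (W : Submodule K V) (hW : ∀ i, ∀ v ∈ W, F i v ∈ W) :
    W ≤ Submodule.span K {v | v ∈ W ∧ ∀ i, ∃ μ : K, F i v = μ • v} := by
  let g (i : κ) : Module.End K W := (F i).restrict (hW i)
  have hg (i : κ) : (g i).IsFinitelySemisimple := (hF i).isFinitelySemisimple.restrict _
  have htop :=
    Module.End.iSup_iInf_maxGenEigenspace_eq_top_of_iSup_maxGenEigenspace_eq_top_of_commute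
      g (fun i j _ => LinearMap.ext fun v => Subtype.ext (LinearMap.congr_fun (hc i j).eq v))
      (fun i => Module.End.iSup_maxGenEigenspace_eq_top _)
  have hle : (⊤ : Submodule K W) ≤
      (Submodule.span K {v | v ∈ W ∧ ∀ i, ∃ μ : K, F i v = μ • v}).comap W.subtype := by
    rw [← htop]
    refine iSup_le fun χ v hv => Submodule.subset_span ⟨v.2, fun i => ⟨χ i, ?_⟩⟩
    have := (Submodule.mem_iInf _).mp hv i
    rw [(hg i).maxGenEigenspace_eq_eigenspace] at this
    exact congrArg Subtype.val (Module.End.mem_eigenspace_iff.mp this)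
  exact fun v hv => hle (Submodule.mem_top (x := ⟨v, hv⟩))

theorem exists_eq_diagConj_of_commute [IsAlgClosed K] {κ : Type*} (F : κ → Matrix ι ι K)
    (hF : ∀ i, Module.End.IsSemisimple (toLin' (F i))) (hc : ∀ i j, Commute (F i) (F j)) :
    ∃ (P : (Matrix ι ι K)ˣ) (d : κ → ι → K), ∀ i, F i = diagConj P (d i) := by
  let E : Set (ι → K) := {v | v ∈ (⊤ : Submodule K _) ∧ ∀ i, ∃ μ : K, toLin' (F i) v = μ • v}
  have hE : Submodule.span K E = ⊤ := top_le_iff.mp <|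
    le_span_joint_eigenvectors (fun i => toLin' (F i)) hF
      (fun i j => (hc i j).map (toLinAlgEquiv' : Matrix ι ι K ≃ₐ[K] _)) ⊤ (by simp)
  have hfr : Module.finrank K (Submodule.span K E) = Fintype.card ι := by
    rw [hE, finrank_top, Module.finrank_fintype_fun_eq_card]
  obtain ⟨b, hbE, -, hbl⟩ := hfr ▸ Submodule.exists_fun_fin_finrank_span_eq K E
  choose _ μ hμ using hbE
  let e := Fintype.equivFin ι
  obtain ⟨P, hP⟩ : IsUnit (Matrix.of fun k l => b (e l) k) :=
    linearIndependent_cols_iff_isUnit.mp (hbl.comp e e.injective)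
  refine ⟨P, fun i l => μ (e l) i, fun i => ?_⟩
  rw [diagConj_apply, Units.eq_mul_inv_iff_mul_eq, hP]
  ext k l
  rw [mul_diagonal, mul_apply]
  simpa [mulVec, dotProduct, mul_comm] using congrFun (hμ (e l) i) k

theorem isNilpotent_of_lie_eq_smul [CharZero K] {A : Type*} [Ring A] [Algebra K A]
    [FiniteDimensional K A] {a b : A} {q : K} (hq : q ≠ 0) (h : ⁅a, b⁆ = q • b) :
    IsNilpotent b := by
  have hpow (k : ℕ) : ⁅a, b ^ k⁆ = ((k : K) * q) • b ^ k := by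
    induction k with
    | zero => simp [Ring.lie_def]
    | succ k ih =>
      have hleibniz : ⁅a, b ^ k * b⁆ = ⁅a, b ^ k⁆ * b + b ^ k * ⁅a, b⁆ := by
        simp only [Ring.lie_def]; noncomm_ring
      rw [pow_succ, hleibniz, ih, h, smul_mul_assoc, mul_smul_comm, ← add_smul]
      push_cast
      ring_nf
  by_contra hb
  have hsub : Set.range (fun k : ℕ => (k : K) * q) ⊆
      {μ | (LieAlgebra.ad K A a).HasEigenvalue μ} := by
    rintro _ ⟨k, rfl⟩
    exact Module.End.hasEigenvalue_of_hasEigenvector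
      (Module.End.hasEigenvector_iff.mpr ⟨Module.End.mem_eigenspace_iff.mpr (hpow k),
        fun hk => hb ⟨k, hk⟩⟩)
  refine Set.infinite_range_of_injective (fun k l hkl => ?_)
    ((Module.End.finite_hasEigenvalue _).subset hsub)
  exact_mod_cast mul_right_cancel₀ hq hkl

theorem exists_sub_eq_of_lie_diagConj_eq_smul {P : (Matrix ι ι K)ˣ} {w : ι → K} {A : Matrix ι ι K}
    (hA : A ≠ 0) {q : K} (h : ⁅diagConj P w, A⁆ = q • A) : ∃ a b, w a - w b = q := by
  by_contra! hcon
  let B : Matrix ι ι K := (↑P⁻¹ : Matrix ι ι K) * A * (P : Matrix ι ι K)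
  have hAB : A = (P : Matrix ι ι K) * B * (↑P⁻¹ : Matrix ι ι K) := by simp [B, mul_assoc]
  have hlie : diagonal w * B - B * diagonal w = q • B := by
    have := congrArg (fun Y => (↑P⁻¹ : Matrix ι ι K) * Y * (P : Matrix ι ι K)) h
    simpa [B, Ring.lie_def, diagConj_apply, mul_sub, sub_mul, mul_assoc] using this
  refine hA ?_
  suffices B = 0 by rw [hAB, this, mul_zero, zero_mul]
  ext a b
  have hab := congrFun (congrFun hlie a) b
  simp only [Matrix.sub_apply, diagonal_mul, mul_diagonal, Matrix.smul_apply, smul_eq_mul] at hab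
  have : (w a - w b - q) * B a b = 0 := by linear_combination hab
  exact (mul_eq_zero.mp this).resolve_left (sub_ne_zero.mpr (hcon a b))

end Semisimple

section Rationality

variable {K L ι κ : Type*} [Field K] [Field L] [Algebra K L] [Fintype ι]

theorem mem_span_algebraMap_of_sum_smul_eq_zero (α : κ → ι → K) (d : ι → L)
    (hd : ∀ a, ∑ k, α a k • d k = 0) :
    d ∈ Submodule.span L
      {v | ∃ u : ι → K, (∀ a, ∑ k, α a k * u k = 0) ∧ v = fun k => algebraMap K L (u k)} := by
  classical
  let B := Module.Basis.ofVectorSpace K L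
  let J := Finset.univ.biUnion fun k => (B.repr (d k)).support
  have hsum : d = ∑ j ∈ J, B j • fun k => algebraMap K L (B.repr (d k) j) := by
    funext k
    conv_lhs => rw [← B.linearCombination_repr (d k), Finsupp.linearCombination_apply]
    rw [Finsupp.sum_of_support_subset (s := J) _
      (Finset.subset_biUnion_of_mem (fun k => (B.repr (d k)).support) (Finset.mem_univ k)) _
      (by simp)]
    simp [Algebra.smul_def, mul_comm]
  rw [hsum]
  refine Submodule.sum_mem _ fun j _ => Submodule.smul_mem _ _ (Submodule.subset_span ?_)
  exact ⟨fun k => B.repr (d k) j, fun a => by simpa using congrArg (fun z => B.repr z j) (hd a),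
    rfl⟩

theorem exists_linearIndependent_span_eq_ker (α : κ → ι → K) :
    ∃ (r : ℕ) (w : Fin r → ι → K), LinearIndependent L (fun i k => algebraMap K L (w i k)) ∧
      ∀ d : ι → L, d ∈ Submodule.span L (Set.range fun i k => algebraMap K L (w i k)) ↔
        ∀ a, ∑ k, α a k • d k = 0 := by
  let S : Set (ι → L) :=
    {v | ∃ u : ι → K, (∀ a, ∑ k, α a k * u k = 0) ∧ v = fun k => algebraMap K L (u k)}
  obtain ⟨b, hbS, hbs, hbl⟩ := Submodule.exists_fun_fin_finrank_span_eq L S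
  choose w _ hbw using hbS
  have hb : b = fun i k => algebraMap K L (w i k) := funext hbw
  refine ⟨_, w, hb ▸ hbl, fun d => ?_⟩
  rw [← hb, hbs]
  refine ⟨fun hd a => ?_, mem_span_algebraMap_of_sum_smul_eq_zero α d⟩
  induction hd using Submodule.span_induction with
  | mem v hv =>
    obtain ⟨u, hu, rfl⟩ := hv
    simpa [Algebra.smul_def] using congrArg (algebraMap K L) (hu a)
  | zero => simp
  | add u v _ _ hu hv => simp [Finset.sum_add_distrib, hu, hv]
  | smul c v _ hv =>
    rw [← smul_zero c, ← hv, Finset.smul_sum]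
    exact Finset.sum_congr rfl fun k _ => smul_comm _ c _

end Rationality

section Jordan

variable {n : ℕ} {A S N S' N' B : Matrix (Fin n) (Fin n) ℂ}

theorem exists_isJordanDecomposition_forall_commute (A : Matrix (Fin n) (Fin n) ℂ) :
    ∃ S N, IsJordanDecomposition A S N ∧ ∀ B, Commute B A → Commute B S := by
  obtain ⟨N, hN, S, hS, hNn, hSs, h⟩ :=
    Module.End.exists_isNilpotent_isSemisimple (f := toLin' A)
  have hc : Commute N S := Algebra.commute_of_mem_adjoin_singleton_of_commute hS
    (Algebra.commute_of_mem_adjoin_singleton_of_commute hN (Commute.refl _)).symm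
  let φ := (toLinAlgEquiv' : Matrix (Fin n) (Fin n) ℂ ≃ₐ[ℂ] _)
  refine ⟨φ.symm S, φ.symm N, ⟨?_, hc.symm.map φ.symm, ?_, hNn.map φ.symm⟩, fun B hB => ?_⟩
  · rw [← map_add, add_comm, ← h]
    exact (φ.symm_apply_apply A).symm
  · change Module.End.IsSemisimple (φ (φ.symm S))
    rwa [φ.apply_symm_apply]
  · simpa using (Algebra.commute_of_mem_adjoin_singleton_of_commute hS (hB.map φ)).map φ.symm

theorem IsJordanDecomposition.unique (h : IsJordanDecomposition A S N)
    (h' : IsJordanDecomposition A S' N') : S = S' := by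
  let φ := (toLinAlgEquiv' : Matrix (Fin n) (Fin n) ℂ ≃ₐ[ℂ] _)
  refine φ.injective (Module.End.isNilpotent_isSemisimple_unique (h.nilpotent.map φ) h.semisimple
    (h'.nilpotent.map φ) h'.semisimple (h.commute.symm.map φ) (h'.commute.symm.map φ) ?_).2
  change φ N + φ S = φ N' + φ S'
  rw [← map_add, ← map_add, add_comm, ← h.eq_add, h'.eq_add, add_comm]

theorem IsJordanDecomposition.commute_left (h : IsJordanDecomposition A S N) (hB : Commute B A) :
    Commute B S := by
  obtain ⟨S', N', h', hS'⟩ := exists_isJordanDecomposition_forall_commute A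
  exact h.unique h' ▸ hS' B hB

end Jordan

section Logarithmic

variable {n : ℕ}

theorem lin_add (A B : Matrix (Fin n) (Fin n) ℂ) (x : Fin n → ℂ) :
    lin (A + B) x = lin A x + lin B x :=
  vecMul_add A B x

theorem lin_smul (c : ℂ) (A : Matrix (Fin n) (Fin n) ℂ) (x : Fin n → ℂ) :
    lin (c • A) x = c • lin A x :=
  vecMul_smul x c A

theorem lin_one (x : Fin n → ℂ) : lin 1 x = x :=
  vecMul_one x

theorem lin_apply_smul (A : Matrix (Fin n) (Fin n) ℂ) (c : ℂ) (x : Fin n → ℂ) :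
    lin A (c • x) = c • lin A x :=
  smul_vecMul c x A

theorem lin_sum_smul {ι : Type*} [Fintype ι] (c : ι → ℂ) (b : ι → Matrix (Fin n) (Fin n) ℂ)
    (x : Fin n → ℂ) : lin (∑ i, c i • b i) x = ∑ i, c i • lin (b i) x := by
  simp only [← lin_smul]
  exact vecMul_sum x _ _

theorem lin_injective : Function.Injective (lin : Matrix (Fin n) (Fin n) ℂ → _) :=
  fun _ _ h => ext_of_single_vecMul fun i => congrFun h (Pi.single i 1)

/-- The vector field `lin A` as a continuous linear map. -/
noncomputable def linCLM (A : Matrix (Fin n) (Fin n) ℂ) : (Fin n → ℂ) →L[ℂ] (Fin n → ℂ) :=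
  LinearMap.toContinuousLinearMap (vecMulLinear A)

theorem analyticOnNhd_lin (A : Matrix (Fin n) (Fin n) ℂ) (U : Set (Fin n → ℂ)) :
    AnalyticOnNhd ℂ (lin A) U :=
  (linCLM A).analyticOnNhd U

variable {f : (Fin n → ℂ) → ℂ} {v w : (Fin n → ℂ) → (Fin n → ℂ)} {x : Fin n → ℂ}

theorem IsReducedEquation.differentiableAt (hf : IsReducedEquation f) (x : Fin n → ℂ) :
    DifferentiableAt ℂ f x :=
  (hf.holomorphic x (Set.mem_univ x)).differentiableAt

theorem IsReducedEquation.isLogarithmic_iff (hf : IsReducedEquation f)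
    (hv : AnalyticOnNhd ℂ v Set.univ) :
    IsLogarithmic f Set.univ v ↔ ∀ x, f x = 0 → fderiv ℂ f x (v x) = 0 := by
  constructor
  · rintro ⟨_, g, _, hg⟩ x hx
    have := hg x (Set.mem_univ x)
    rwa [hx, mul_zero] at this
  · refine fun h => ⟨hv, hf.reduced Set.univ _ isOpen_univ (fun x hx => ?_) fun x _ => h x⟩
    exact ((ContinuousLinearMap.apply ℂ ℂ).flip.analyticAt_bilinear (fderiv ℂ f x, v x)).comp₂
      (hf.holomorphic.fderiv x hx) (hv x hx)

theorem IsReducedEquation.isLogarithmic_smul_const (hf : IsReducedEquation f) (e : Fin n → ℂ) :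
    IsLogarithmic f Set.univ fun x => f x • e :=
  (hf.isLogarithmic_iff fun x hx => (hf.holomorphic x hx).smul analyticAt_const).mpr
    fun x hx => by simp [hx]

theorem IsLogarithmic.fderiv_act_eq_zero (hv : IsLogarithmic f Set.univ v)
    (hf : DifferentiableAt ℂ f x) (hx : f x = 0) {y : Fin n → ℂ} (hy : fderiv ℂ f x y = 0) :
    fderiv ℂ (act v f) x y = 0 := by
  obtain ⟨-, g, hg, hgf⟩ := hv
  have : act v f = fun z => g z * f z := funext fun z => hgf z (Set.mem_univ z)
  rw [this, fderiv_fun_mul (hg x (Set.mem_univ x)).differentiableAt hf]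
  simp [hx, hy]

theorem IsReducedEquation.isLogarithmic_lieBracket (hf : IsReducedEquation f)
    (hv : IsLogarithmic f Set.univ v) (hw : IsLogarithmic f Set.univ w)
    (hvw : AnalyticOnNhd ℂ (VectorField.lieBracket ℂ v w) Set.univ) :
    IsLogarithmic f Set.univ (VectorField.lieBracket ℂ v w) := by
  refine (hf.isLogarithmic_iff hvw).mpr fun x hx => ?_
  have hv0 := (hf.isLogarithmic_iff hv.1).mp hv x hx
  have hw0 := (hf.isLogarithmic_iff hw.1).mp hw x hx
  rw [VectorField.fderiv_apply_lieBracket (n := ⊤)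
    (hf.holomorphic x (Set.mem_univ x)).contDiffAt (by simp)
    (hw.1 x (Set.mem_univ x)).differentiableAt (hv.1 x (Set.mem_univ x)).differentiableAt]
  exact (congrArg₂ (· - ·) (hw.fderiv_act_eq_zero (hf.differentiableAt x) hx hv0)
    (hv.fderiv_act_eq_zero (hf.differentiableAt x) hx hw0)).trans (sub_zero 0)

/-- The space of logarithmic vector fields of degree `0`, as a space of matrices. It is defined by
tangency to `{f = 0}`, which makes it a subspace for every `f`. -/
def tangentMatrices (f : (Fin n → ℂ) → ℂ) : Submodule ℂ (Matrix (Fin n) (Fin n) ℂ) where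
  carrier := {A | ∀ x, f x = 0 → fderiv ℂ f x (lin A x) = 0}
  add_mem' hA hB x hx := by rw [lin_add, map_add, hA x hx, hB x hx, add_zero]
  zero_mem' x _ := by simp [lin]
  smul_mem' c A hA x hx := by rw [lin_smul, map_smul, hA x hx, smul_zero]

theorem isLogarithmic_lin_iff (hf : IsReducedEquation f) {A : Matrix (Fin n) (Fin n) ℂ} :
    IsLogarithmic f Set.univ (lin A) ↔ A ∈ tangentMatrices f :=
  hf.isLogarithmic_iff (analyticOnNhd_lin A _)

theorem lie_mem_tangentMatrices (hf : IsReducedEquation f) {A B : Matrix (Fin n) (Fin n) ℂ}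
    (hA : A ∈ tangentMatrices f) (hB : B ∈ tangentMatrices f) : ⁅A, B⁆ ∈ tangentMatrices f := by
  rw [← isLogarithmic_lin_iff hf, ← lieBracket_lin] at *
  exact hf.isLogarithmic_lieBracket hA hB (lieBracket_lin A B ▸ analyticOnNhd_lin _ _)

end Logarithmic

section LogBasis

variable {n : ℕ} {f : (Fin n → ℂ) → ℂ} {ι κ : Type} [Fintype ι] [Fintype κ]
  {b : ι → Matrix (Fin n) (Fin n) ℂ} {e : κ → Matrix (Fin n) (Fin n) ℂ}

theorem IsLogBasis.linearIndependent (hb : IsLogBasis f Set.univ fun i => lin (b i)) :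
    LinearIndependent ℂ b := by
  refine Fintype.linearIndependent_iff.mpr fun c hc i => ?_
  refine hb.2.2 (fun i _ => c i) (fun _ _ => 0) (fun _ => analyticOnNhd_const)
    (fun _ => analyticOnNhd_const) (fun x _ => ?_) i 0 (Set.mem_univ _)
  rw [← lin_sum_smul, hc]
  simp [lin]

-- Rescaling the argument gives `lin A x = ∑ᵢ hᵢ(tx) lin (bᵢ) x` for `t ≠ 0`; then let `t → 0`.
theorem eq_sum_apply_zero_smul {A : Matrix (Fin n) (Fin n) ℂ} {h : ι → (Fin n → ℂ) → ℂ}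
    (hh : ∀ i, Continuous (h i)) (hA : ∀ x, lin A x = ∑ i, h i x • lin (b i) x) :
    A = ∑ i, h i 0 • b i := by
  refine lin_injective (funext fun x => ?_)
  have hscale (t : ℂ) (ht : t ≠ 0) : lin A x = ∑ i, h i (t • x) • lin (b i) x := by
    refine smul_right_injective _ ht ?_
    simp only [← lin_apply_smul, hA (t • x), Finset.smul_sum]
    simp only [lin_apply_smul, smul_comm t]
  have hcont : Continuous fun t : ℂ => ∑ i, h i (t • x) • lin (b i) x := by fun_prop
  have hlim := (hcont.tendsto 0).mono_left (nhdsWithin_le_nhds (s := {0}ᶜ))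
  have hconst : Tendsto (fun t : ℂ => ∑ i, h i (t • x) • lin (b i) x) (𝓝[≠] 0) (𝓝 (lin A x)) :=
    tendsto_const_nhds.congr' (eventually_nhdsWithin_of_forall hscale)
  simpa [lin_sum_smul] using tendsto_nhds_unique hconst hlim

theorem IsLogBasis.span_eq (hf : IsReducedEquation f)
    (hb : IsLogBasis f Set.univ fun i => lin (b i)) :
    Submodule.span ℂ (Set.range b) = tangentMatrices f := by
  refine le_antisymm (Submodule.span_le.mpr ?_) fun A hA => ?_
  · rintro _ ⟨i, rfl⟩
    exact (isLogarithmic_lin_iff hf).mp (hb.1 i)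
  · obtain ⟨h, hh, hv⟩ := hb.2.1 _ ((isLogarithmic_lin_iff hf).mpr hA)
    rw [eq_sum_apply_zero_smul (fun i => continuousOn_univ.mp (hh i).continuousOn)
      fun x => hv x (Set.mem_univ x)]
    exact Submodule.sum_mem _ fun i _ => Submodule.smul_mem _ _ (Submodule.subset_span ⟨i, rfl⟩)

theorem exists_forall_sum_smul_eq_of_range_subset_span {R M ι κ : Type*} [CommSemiring R]
    [AddCommMonoid M] [Module R M] [Fintype ι] [Fintype κ] {b : ι → M} {e : κ → M}
    (h : Set.range b ⊆ Submodule.span R (Set.range e)) :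
    ∃ T : ι → κ → R, ∀ c : ι → R, ∑ i, c i • b i = ∑ k, (∑ i, c i * T i k) • e k := by
  choose T hT using fun i => (Submodule.mem_span_range_iff_exists_fun R).mp (h ⟨i, rfl⟩)
  refine ⟨T, fun c => ?_⟩
  simp only [← hT, Finset.smul_sum, Finset.sum_smul, smul_smul]
  exact Finset.sum_comm

theorem IsLogBasis.of_span_eq (hf : IsReducedEquation f)
    (hb : IsLogBasis f Set.univ fun i => lin (b i)) (he : LinearIndependent ℂ e)
    (hspan : Submodule.span ℂ (Set.range e) = tangentMatrices f) :
    IsLogBasis f Set.univ fun k => lin (e k) := by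
  have hbe := (hb.span_eq hf).trans hspan.symm
  obtain ⟨T, hT⟩ := exists_forall_sum_smul_eq_of_range_subset_span
    (Submodule.subset_span.trans hbe.le)
  obtain ⟨Q, hQ⟩ := exists_forall_sum_smul_eq_of_range_subset_span
    (Submodule.subset_span.trans hbe.ge)
  refine ⟨fun k => ?_, fun v hv => ?_, fun h h' hh hh' heq k x hx => ?_⟩
  · rw [isLogarithmic_lin_iff hf, ← hspan]
    exact Submodule.subset_span ⟨k, rfl⟩
  · obtain ⟨h, hh, hv⟩ := hb.2.1 v hv
    refine ⟨fun k x => ∑ i, h i x * T i k, fun k => ?_, fun x hx => ?_⟩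
    · exact Finset.analyticOnNhd_fun_sum _ fun i _ => (hh i).mul analyticOnNhd_const
    · rw [hv x hx, ← lin_sum_smul, ← lin_sum_smul, hT]
  · have han {g : κ → (Fin n → ℂ) → ℂ} (hg : ∀ k, AnalyticOnNhd ℂ (g k) Set.univ) (i : ι) :
        AnalyticOnNhd ℂ (fun y => ∑ k, g k y * Q k i) Set.univ :=
      Finset.analyticOnNhd_fun_sum _ fun k _ => (hg k).mul analyticOnNhd_const
    have hcoord (i : ι) : ∑ k, h k x * Q k i = ∑ k, h' k x * Q k i :=
      hb.2.2 _ _ (han hh) (han hh') (fun y hy => by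
        simpa only [← lin_sum_smul, hQ] using heq y hy) i x hx
    have hcomb : ∑ k, h k x • e k = ∑ k, h' k x • e k := by
      rw [hQ, hQ, Finset.sum_congr rfl fun i _ => by rw [hcoord i]]
    exact Fintype.linearIndependent_iffₛ.mp he _ _ hcomb k

end LogBasis

section ZeroSet

theorem eq_zero_of_mul_deriv_eq {u a b : ℂ → ℂ} (hu : AnalyticOnNhd ℂ u Set.univ)
    (ha : AnalyticAt ℂ a 0) (hb : AnalyticAt ℂ b 0) (ha0 : a 0 ≠ 0) (hu0 : u 0 = 0)
    (h : ∀ t, a t * deriv u t = b t * u t) : u = 0 := by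
  have hu' := hu 0 (Set.mem_univ _)
  refine AnalyticOnNhd.eq_of_eventuallyEq hu (fun _ _ => analyticAt_const)
    (analyticOrderAt_eq_top (z₀ := 0).mp ?_)
  by_contra hne
  have hderiv : analyticOrderAt (deriv u) 0 + 1 = analyticOrderAt u 0 := by
    simpa [hu0] using hu'.analyticOrderAt_deriv_add_one
  have hord : analyticOrderAt (a * deriv u) 0 = analyticOrderAt (b * u) 0 :=
    congrArg (analyticOrderAt · 0) (funext h)
  rw [analyticOrderAt_mul ha hu'.deriv, analyticOrderAt_mul hb hu',
    ha.analyticOrderAt_eq_zero.mpr ha0, zero_add, ← hderiv] at hord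
  lift analyticOrderAt (deriv u) 0 to ℕ using (fun ht => hne (by rw [← hderiv, ht]; rfl)) with m
  have hle : (m : ℕ∞) + 1 ≤ m := le_add_self.trans_eq hord.symm
  exact absurd hle (by exact_mod_cast Nat.not_succ_le_self m)

theorem eq_zero_of_forall_mul_fderiv_eq {E : Type*} [NormedAddCommGroup E] [NormedSpace ℂ E]
    {g a : E → ℂ} (hg : AnalyticOnNhd ℂ g Set.univ) (ha : AnalyticOnNhd ℂ a Set.univ) {x : E}
    (hax : a x ≠ 0) (hgx : g x = 0)
    (h : ∀ v, ∃ b : E → ℂ, AnalyticOnNhd ℂ b Set.univ ∧ ∀ z, a z * fderiv ℂ g z v = b z * g z) :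
    g = 0 := by
  funext y
  obtain ⟨b, hb, hbg⟩ := h (y - x)
  let l : ℂ → E := fun t => x + t • (y - x)
  have hl (k : E → ℂ) (hk : AnalyticOnNhd ℂ k Set.univ) (t : ℂ) :
      AnalyticAt ℂ (fun t => k (l t)) t :=
    (hk (l t) (Set.mem_univ _)).comp
      (analyticAt_const.add (analyticAt_id.smul analyticAt_const))
  have hderiv (t : ℂ) : deriv (fun t => g (l t)) t = fderiv ℂ g (l t) (y - x) := by
    have hlt : HasDerivAt l (y - x) t := by
      simpa only [one_smul] using! ((hasDerivAt_id t).smul_const (y - x)).const_add x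
    exact ((hg (l t) (Set.mem_univ _)).differentiableAt.hasFDerivAt.comp_hasDerivAt t hlt).deriv
  have hzero : (fun t => g (l t)) = 0 :=
    eq_zero_of_mul_deriv_eq (fun t _ => hl g hg t) (hl a ha 0) (hl b hb 0) (by simpa [l] using hax)
      (by simpa [l] using hgx) fun t => by rw [hderiv, hbg]
  simpa [l] using congrFun hzero 1

variable {n : ℕ} {f : (Fin n → ℂ) → ℂ} {δ : Fin n → Matrix (Fin n) (Fin n) ℂ}

theorem discr_eq_det (δ : Fin n → Matrix (Fin n) (Fin n) ℂ) (x : Fin n → ℂ) :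
    discr δ x = (Matrix.of fun i => lin (δ i) x).det := rfl

theorem discr_ne_zero_of_ne_zero (hf : IsReducedEquation f)
    (hδ : IsLogBasis f Set.univ fun i => lin (δ i)) {x : Fin n → ℂ} (hx : f x ≠ 0) :
    discr δ x ≠ 0 := by
  choose h _ hv using fun e => hδ.2.1 _ (hf.isLogarithmic_smul_const e)
  rw [discr_eq_det, ← isUnit_iff_ne_zero, ← isUnit_iff_isUnit_det, ← vecMul_surjective_iff_isUnit]
  refine fun e => ⟨(f x)⁻¹ • fun i => h e i x, ?_⟩
  change vecMul _ _ = e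
  rw [smul_vecMul, vecMul_eq_sum, inv_smul_eq_iff₀ hx]
  exact (hv e x (Set.mem_univ x)).symm

theorem discr_smul_eq_sum (δ : Fin n → Matrix (Fin n) (Fin n) ℂ) (v z : Fin n → ℂ) :
    discr δ z • v =
      ∑ i, eval z (∑ j, C (v j) * (saitoMatrix δ).adjugate j i) • lin (δ i) z := by
  let M : Matrix (Fin n) (Fin n) ℂ := Matrix.of fun i => lin (δ i) z
  have hM : (eval z).mapMatrix (saitoMatrix δ) = M := by
    ext i j
    simp [M, saitoMatrix, eval_linDer_X, -linDer_X]
  have hadj : vecMul (vecMul v M.adjugate) M = discr δ z • v := by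
    rw [vecMul_vecMul, adjugate_mul, vecMul_smul, vecMul_one, discr_eq_det]
  rw [← hadj, vecMul_eq_sum (v ᵥ* M.adjugate) M, ← hM, ← RingHom.map_adjugate]
  have hcoeff (i : Fin n) : eval z (∑ j, C (v j) * (saitoMatrix δ).adjugate j i) =
      (v ᵥ* (eval z).mapMatrix (saitoMatrix δ).adjugate) i := by
    simp [vecMul, dotProduct]
  simp only [hcoeff, hM]
  rfl

theorem exists_discr_mul_fderiv_eq (hδ : IsLogBasis f Set.univ fun i => lin (δ i))
    (v : Fin n → ℂ) : ∃ b : (Fin n → ℂ) → ℂ, AnalyticOnNhd ℂ b Set.univ ∧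
      ∀ z, discr δ z * fderiv ℂ f z v = b z * f z := by
  choose _ g hg hgf using hδ.1
  let c (i : Fin n) : MvPolynomial (Fin n) ℂ := ∑ j, C (v j) * (saitoMatrix δ).adjugate j i
  have hc (i : Fin n) : AnalyticOnNhd ℂ (fun z => eval z (c i) * g i z) Set.univ :=
    (AnalyticOnNhd.eval_mvPolynomial (c i)).mul (hg i)
  refine ⟨fun z => ∑ i, eval z (c i) * g i z, Finset.analyticOnNhd_fun_sum _ fun i _ => hc i,
    fun z => ?_⟩
  have hsum : discr δ z • v = ∑ i, eval z (c i) • lin (δ i) z := discr_smul_eq_sum δ v z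
  rw [← smul_eq_mul, ← map_smul, hsum, map_sum, Finset.sum_mul]
  refine Finset.sum_congr rfl fun i _ => ?_
  rw [map_smul, smul_eq_mul, mul_assoc, ← hgf i z (Set.mem_univ z), act]

theorem eq_zero_iff_discr_eq_zero (hf : IsReducedEquation f)
    (hδ : IsLogBasis f Set.univ fun i => lin (δ i)) (x : Fin n → ℂ) :
    f x = 0 ↔ discr δ x = 0 := by
  refine ⟨fun hx => ?_, fun h => by_contra fun hx => discr_ne_zero_of_ne_zero hf hδ hx h⟩
  by_contra hne
  obtain ⟨y, hy⟩ := hf.ne_zero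
  refine hy (congrFun (eq_zero_of_forall_mul_fderiv_eq hf.holomorphic ?_ hne hx
    (exists_discr_mul_fderiv_eq hδ)) y)
  rw [← funext (eval_discrPoly δ)]
  exact AnalyticOnNhd.eval_mvPolynomial _

-- The flow `exp(tA)` multiplies `p` by `exp(ct)`, so it preserves the zero set.
theorem mem_tangentMatrices_of_linDer_eq_smul {p : MvPolynomial (Fin n) ℂ}
    (hf : Differentiable ℂ f) (hp : ∀ x, f x = 0 ↔ eval x p = 0) {A : Matrix (Fin n) (Fin n) ℂ}
    {c : ℂ} (h : linDer A p = c • p) : A ∈ tangentMatrices f := by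
  intro x hx
  let γ : ℂ → (Fin n → ℂ) := fun t => NormedSpace.exp (t • linCLM A) x
  have hγ0 : γ 0 = x := by
    have : (0 : ℂ) • linCLM A = 0 := by ext; simp
    simp [γ, this]
  have hγ (t : ℂ) : HasDerivAt γ (lin A (γ t)) t := by
    simpa using! (hasDerivAt_exp_smul_const' (linCLM A) t).clm_apply (hasDerivAt_const t x)
  have hpγ (t : ℂ) : HasDerivAt (fun t => eval (γ t) p) (c * eval (γ t) p) t := by
    obtain ⟨p', hp', hpA⟩ := hasFDerivAt_eval p (γ t)
    have := hp'.comp_hasDerivAt t (hγ t)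
    rwa [hpA, h, smul_eval] at this
  have hpγ0 : (fun t => eval (γ t) p) = 0 :=
    eq_zero_of_mul_deriv_eq (a := fun _ => 1) (b := fun _ => c)
      (fun t _ => Differentiable.analyticAt (fun t => (hpγ t).differentiableAt) t)
      analyticAt_const analyticAt_const one_ne_zero (by rw [hγ0]; exact (hp x).mp hx)
      fun t => by rw [(hpγ t).deriv, one_mul]
  have hfγ : f ∘ γ = fun _ => 0 := funext fun t => (hp _).mpr (congrFun hpγ0 t)
  have hderiv := (hf (γ 0)).hasFDerivAt.comp_hasDerivAt 0 (hγ 0)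
  rw [hfγ, hγ0] at hderiv
  exact hderiv.unique (hasDerivAt_const 0 0)

end ZeroSet

section Triangular

theorem exists_forall_dotProduct_eq {K ι κ : Type*} [Field K] [Fintype ι] {y : κ → ι → K}
    (hy : LinearIndependent K y) (c : κ → K) : ∃ e : ι → K, ∀ i, e ⬝ᵥ y i = c i := by
  classical
  obtain ⟨φ, hφ⟩ := LinearMap.exists_extend ((Finsupp.linearCombination K c).comp hy.repr)
  have hφy (i : κ) : φ (y i) = c i := by
    let z : Submodule.span K (Set.range y) := ⟨y i, Submodule.subset_span ⟨i, rfl⟩⟩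
    calc φ (y i) = Finsupp.linearCombination K c (hy.repr z) := LinearMap.congr_fun hφ z
      _ = c i := by rw [hy.repr_eq_single i z rfl, Finsupp.linearCombination_single, one_smul]
  refine ⟨fun k => φ (Pi.single k 1), fun i => ?_⟩
  rw [← hφy i]
  conv_rhs => rw [pi_eq_sum_univ' (y i)]
  simp [dotProduct, mul_comm]

theorem eq_zero_of_forall_mul_dotProduct_eq_zero {n : ℕ} {k : (Fin n → ℂ) → ℂ}
    (hk : Continuous k) {x y e : Fin n → ℂ} (hey : e ⬝ᵥ y ≠ 0)
    (h : ∀ t : ℂ, k (x + t • e) * ((x + t • e) ⬝ᵥ y) = 0) : k x = 0 := by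
  have hzero : (fun t : ℂ => k (x + t • e)) = fun _ => 0 := by
    refine Continuous.ext_on (dense_compl_singleton (-(x ⬝ᵥ y) / (e ⬝ᵥ y))) (by fun_prop)
      continuous_const fun t ht => (mul_eq_zero.mp (h t)).resolve_right fun ht' => ht ?_
    rw [add_dotProduct, smul_dotProduct, smul_eq_mul] at ht'
    exact (eq_div_iff hey).mpr (eq_neg_of_add_eq_zero_right ht')
  simpa using congrFun hzero 0

variable {n : ℕ} {f : (Fin n → ℂ) → ℂ}

theorem IsReducedEquation.ne_zero_of_eq_mul (hf : IsReducedEquation f) {k l : (Fin n → ℂ) → ℂ}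
    (hk : AnalyticOnNhd ℂ k Set.univ) (hl : Continuous l) (hkl : ∀ x, f x = k x * l x)
    (h : ∀ x, l x = 0 → k x = 0) (x : Fin n → ℂ) : l x ≠ 0 := by
  intro hx
  obtain ⟨q, hq, hkq⟩ := hf.reduced Set.univ k isOpen_univ hk fun z _ hz =>
    (mul_eq_zero.mp ((hkl z).symm.trans hz)).elim id (h z)
  have hqc : Continuous q := continuousOn_univ.mp hq.continuousOn
  have hunit : ∀ᶠ z in 𝓝 x, 1 - q z * l z ≠ 0 :=
    (by fun_prop : Continuous fun z => 1 - q z * l z).continuousAt.eventually_ne (by simp [hx])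
  have hf0 : f =ᶠ[𝓝 x] 0 := by
    filter_upwards [hunit] with z hz
    have hkz : k z * (1 - q z * l z) = 0 := by
      linear_combination hkq z (Set.mem_univ z) + q z * hkl z
    rw [hkl, (mul_eq_zero.mp hkz).resolve_right hz, zero_mul, Pi.zero_apply]
  obtain ⟨z, hz⟩ := hf.ne_zero
  exact hz (congrFun (hf.holomorphic.eq_of_eventuallyEq (fun _ _ => analyticAt_const) hf0) z)

theorem not_isLogBasis_of_triangular (hf : IsReducedEquation f) {κ : Type}
    [Fintype κ] {ν : κ → Matrix (Fin n) (Fin n) ℂ} {y₁ y₂ : Fin n → ℂ}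
    (hy : LinearIndependent ℂ ![y₁, y₂]) (h₁ : ∀ j, ν j *ᵥ y₁ = 0)
    (h₂ : ∀ j, ∃ c : ℂ, ν j *ᵥ y₂ = c • y₁) :
    ¬ IsLogBasis f Set.univ fun i => lin (Sum.elim (fun _ : Unit => 1) ν i) := by
  intro hb
  choose c hc using h₂
  obtain ⟨e, he⟩ := exists_forall_dotProduct_eq hy ![1, 0]
  obtain ⟨e', he'⟩ := exists_forall_dotProduct_eq hy ![0, 1]
  obtain ⟨he₁, he₂⟩ : e ⬝ᵥ y₁ = 1 ∧ e ⬝ᵥ y₂ = 0 := ⟨he 0, he 1⟩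
  obtain ⟨he'₁, he'₂⟩ : e' ⬝ᵥ y₁ = 0 ∧ e' ⬝ᵥ y₂ = 1 := ⟨he' 0, he' 1⟩
  obtain ⟨h, hh, hv⟩ := hb.2.1 (fun x => f x • e) (hf.isLogarithmic_smul_const e)
  have hdot (y x : Fin n → ℂ) : f x * (e ⬝ᵥ y) = h (Sum.inl ()) x * (x ⬝ᵥ y) +
      ∑ j, h (Sum.inr j) x * (x ⬝ᵥ (ν j *ᵥ y)) := by
    have := congrArg (· ⬝ᵥ y) (hv x (Set.mem_univ x))
    simpa [Fintype.sum_sum_type, add_dotProduct, sum_dotProduct, smul_dotProduct, lin_one, lin,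
      dotProduct_mulVec] using this
  have hf₁ (x : Fin n → ℂ) : f x = h (Sum.inl ()) x * (x ⬝ᵥ y₁) := by
    simpa [he₁, h₁] using hdot y₁ x
  have hf₂ (x : Fin n → ℂ) (hx : x ⬝ᵥ y₁ = 0) : h (Sum.inl ()) x * (x ⬝ᵥ y₂) = 0 := by
    simpa [he₂, hc, dotProduct_smul, hx] using (hdot y₂ x).symm
  have hk (x : Fin n → ℂ) (hx : x ⬝ᵥ y₁ = 0) : h (Sum.inl ()) x = 0 :=
    eq_zero_of_forall_mul_dotProduct_eq_zero (continuousOn_univ.mp (hh _).continuousOn)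
      (he'₂.trans_ne one_ne_zero) fun t => hf₂ _ (by simp [add_dotProduct, hx, he'₁])
  exact hf.ne_zero_of_eq_mul (hh _) (by fun_prop : Continuous fun x : Fin n → ℂ => x ⬝ᵥ y₁)
    hf₁ hk 0 (zero_dotProduct _)

end Triangular

section Discriminant

theorem exists_discrPoly_eq_smul {R ι : Type*} [CommRing R] [Fintype ι] [DecidableEq ι]
    {b δ : ι → Matrix ι ι R} (h : Set.range b ⊆ Submodule.span R (Set.range δ)) :
    ∃ c : R, discrPoly b = c • discrPoly δ := by
  choose T hT using fun i => (Submodule.mem_span_range_iff_exists_fun R).mp (h ⟨i, rfl⟩)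
  have hmul : saitoMatrix b = (Matrix.of T).map MvPolynomial.C * saitoMatrix δ := by
    refine Matrix.ext fun i j => ?_
    have hlin : linDer (∑ k, T i k • δ k) (X j) = ∑ k, T i k • linDer (δ k) (X j) := by
      simp only [map_sum, map_smul]
      rw [← Derivation.coeFnAddMonoidHom_apply, map_sum, Finset.sum_apply]
      rfl
    simp only [saitoMatrix, mul_apply, of_apply, map_apply, ← hT, hlin, smul_eq_C_mul]
  refine ⟨(Matrix.of T).det, ?_⟩
  rw [discrPoly, hmul, det_mul, smul_eq_C_mul, RingHom.map_det]
  rfl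

variable {n : ℕ} {f : (Fin n → ℂ) → ℂ} {δ : Fin n → Matrix (Fin n) (Fin n) ℂ}

theorem discrPoly_ne_zero (hf : IsReducedEquation f)
    (hδ : IsLogBasis f Set.univ fun i => lin (δ i)) : discrPoly δ ≠ 0 := by
  intro h
  obtain ⟨x, hx⟩ := hf.ne_zero
  exact discr_ne_zero_of_ne_zero hf hδ hx (by rw [← eval_discrPoly, h, map_zero])

theorem mem_tangentMatrices_iff (hf : IsReducedEquation f)
    (hδ : IsLogBasis f Set.univ fun i => lin (δ i)) {A : Matrix (Fin n) (Fin n) ℂ} :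
    A ∈ tangentMatrices f ↔ ∃ c : ℂ, linDer A (discrPoly δ) = c • discrPoly δ := by
  constructor
  · intro hA
    have hspan := hδ.span_eq hf
    have hlie (i : Fin n) : ∃ c : Fin n → ℂ, ∑ k, c k • δ k = ⁅A, δ i⁆ := by
      rw [← Submodule.mem_span_range_iff_exists_fun, hspan]
      exact lie_mem_tangentMatrices hf hA (hspan ▸ Submodule.subset_span ⟨i, rfl⟩)
    choose C hC using hlie
    exact ⟨_, linDer_discrPoly (C := Matrix.of C) fun i => (hC i).symm⟩
  · rintro ⟨c, hc⟩
    exact mem_tangentMatrices_of_linDer_eq_smul (fun x => hf.differentiableAt x)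
      (fun x => by rw [eq_zero_iff_discr_eq_zero hf hδ, eval_discrPoly]) hc

theorem mem_tangentMatrices_of_linDer_eq_zero (hf : IsReducedEquation f)
    (hδ : IsLogBasis f Set.univ fun i => lin (δ i)) {A : Matrix (Fin n) (Fin n) ℂ}
    (hA : linDer A (discrPoly δ) = 0) : A ∈ tangentMatrices f :=
  (mem_tangentMatrices_iff hf hδ).mpr ⟨0, by rw [hA, zero_smul]⟩

theorem one_mem_tangentMatrices (hf : IsReducedEquation f)
    (hδ : IsLogBasis f Set.univ fun i => lin (δ i)) : 1 ∈ tangentMatrices f :=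
  (mem_tangentMatrices_iff hf hδ).mpr ⟨_, linDer_one_discrPoly δ⟩

theorem linDer_smul_one_discrPoly_eq_zero_iff [NeZero n] (hf : IsReducedEquation f)
    (hδ : IsLogBasis f Set.univ fun i => lin (δ i)) {c : ℂ} :
    linDer (c • 1) (discrPoly δ) = 0 ↔ c = 0 := by
  rw [map_smul, Derivation.smul_apply, linDer_one_discrPoly, smul_smul, smul_eq_zero_iff_left
    (discrPoly_ne_zero hf hδ), mul_eq_zero_iff_right (by simp [NeZero.ne n])]

theorem exists_linDer_sub_smul_one_eq_zero [NeZero n] (hf : IsReducedEquation f)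
    (hδ : IsLogBasis f Set.univ fun i => lin (δ i)) {A : Matrix (Fin n) (Fin n) ℂ}
    (hA : A ∈ tangentMatrices f) : ∃ c : ℂ, linDer (A - c • 1) (discrPoly δ) = 0 := by
  obtain ⟨c, hc⟩ := (mem_tangentMatrices_iff hf hδ).mp hA
  refine ⟨c / n, ?_⟩
  rw [map_sub, map_smul, Derivation.sub_apply, Derivation.smul_apply, hc, linDer_one_discrPoly,
    smul_smul, Fintype.card_fin, div_mul_cancel₀ c (Nat.cast_ne_zero.mpr (NeZero.ne n)), sub_self]

theorem IsJordanDecomposition.linDer_semisimple {A S N : Matrix (Fin n) (Fin n) ℂ}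
    (h : IsJordanDecomposition A S N) {c : ℂ} {p : MvPolynomial (Fin n) ℂ}
    (hA : linDer A p = c • p) : linDer S p = c • p := by
  obtain ⟨P, d, hd⟩ := exists_eq_diagConj_of_commute (fun _ : Unit => S)
    (fun _ => h.semisimple) fun _ _ => Commute.refl S
  have hS : S = diagConj P (d ()) := hd ()
  rw [h.eq_add] at hA
  have hSN := h.commute
  rw [hS] at hA hSN ⊢
  exact linDer_eq_smul_of_diagConj_add h.nilpotent hSN hA

theorem IsJordanDecomposition.linDer_nilpotent {A S N : Matrix (Fin n) (Fin n) ℂ}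
    (h : IsJordanDecomposition A S N) {c : ℂ} {p : MvPolynomial (Fin n) ℂ}
    (hA : linDer A p = c • p) : linDer N p = 0 := by
  have hSN : linDer S p + linDer N p = c • p := by
    rw [← hA, h.eq_add, map_add, Derivation.add_apply]
  rwa [h.linDer_semisimple hA, add_eq_left] at hSN

theorem IsLogBasis.card_eq (hf : IsReducedEquation f) {ι κ : Type} [Fintype ι] [Fintype κ]
    {b : ι → Matrix (Fin n) (Fin n) ℂ} {e : κ → Matrix (Fin n) (Fin n) ℂ}
    (hb : IsLogBasis f Set.univ fun i => lin (b i))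
    (he : IsLogBasis f Set.univ fun k => lin (e k)) : Fintype.card ι = Fintype.card κ := by
  rw [← finrank_span_eq_card hb.linearIndependent, ← finrank_span_eq_card he.linearIndependent,
    hb.span_eq hf, he.span_eq hf]

theorem sum_add_trace_eq_zero_of_lie_eq_smul (hf : IsReducedEquation f)
    (hδ : IsLogBasis f Set.univ fun i => lin (δ i)) {ι : Type} [Fintype ι]
    {b : ι → Matrix (Fin n) (Fin n) ℂ} (hb : IsLogBasis f Set.univ fun i => lin (b i))
    {A : Matrix (Fin n) (Fin n) ℂ} (hA : linDer A (discrPoly δ) = 0) {c : ι → ℂ}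
    (hc : ∀ i, ⁅A, b i⁆ = c i • b i) : ∑ i, c i + A.trace = 0 := by
  let e : Fin n ≃ ι := Fintype.equivOfCardEq (hδ.card_eq hf hb)
  have hspan : Submodule.span ℂ (Set.range (b ∘ e)) = tangentMatrices f := by
    rw [e.surjective.range_comp, hb.span_eq hf]
  have hbe : IsLogBasis f Set.univ fun i => lin ((b ∘ e) i) :=
    hδ.of_span_eq hf (hb.linearIndependent.comp e e.injective) hspan
  obtain ⟨a, ha⟩ := exists_discrPoly_eq_smul
    (Submodule.subset_span.trans (hspan.trans (hδ.span_eq hf).symm).le)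
  have hbA : linDer A (discrPoly (b ∘ e)) =
      ((diagonal (c ∘ e)).trace + A.trace) • discrPoly (b ∘ e) :=
    linDer_discrPoly fun i => by simp [diagonal_apply, hc]
  have hbA0 : linDer A (discrPoly (b ∘ e)) = 0 := by rw [ha, Derivation.map_smul, hA, smul_zero]
  rw [← e.sum_comp]
  simpa [hbA0, discrPoly_ne_zero hf hbe] using hbA.symm

end Discriminant

section Torus

theorem exists_linearIndependent_span_eq_linDer_ker {K L ι : Type*} [Field K] [Field L]
    [Algebra K L] [Fintype ι] [DecidableEq ι] [CharZero K] (P : (Matrix ι ι L)ˣ)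
    (p : MvPolynomial ι L) :
    ∃ (r : ℕ) (w : Fin r → ι → K), LinearIndependent L (fun i k => algebraMap K L (w i k)) ∧
      ∀ d : ι → L, d ∈ Submodule.span L (Set.range fun i k => algebraMap K L (w i k)) ↔
        linDer (diagConj P d) p = 0 := by
  obtain ⟨r, w, hw, hspan⟩ := exists_linearIndependent_span_eq_ker (L := L)
    fun (α : (subst (↑P⁻¹ : Matrix ι ι L) p).support) k => (α.1 k : K)
  refine ⟨r, w, hw, fun d => ?_⟩
  rw [hspan, ← zero_smul L p, linDer_diagConj_eq_smul_iff]
  simp [IsWeightedHomogeneous, Finsupp.weight_apply, Finsupp.sum_fintype, Algebra.smul_def,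
    -coe_units_inv]

variable {n : ℕ} {f : (Fin n → ℂ) → ℂ} {δ : Fin n → Matrix (Fin n) (Fin n) ℂ}

theorem card_mem_diagonalRanks (hf : IsReducedEquation f) {κ : Type*} [Fintype κ]
    {F : κ → Matrix (Fin n) (Fin n) ℂ} (hF : LinearIndependent ℂ F)
    (hss : ∀ i, Module.End.IsSemisimple (toLin' (F i))) (hc : ∀ i j, Commute (F i) (F j))
    (hmem : ∀ i, F i ∈ tangentMatrices f) : Fintype.card κ ∈ diagonalRanks f := by
  obtain ⟨P, d, hd⟩ := exists_eq_diagConj_of_commute F hss hc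
  have hdlin : LinearIndependent ℂ d := by
    rw [funext hd] at hF
    exact hF.of_comp (diagConj P).toLinearMap
  let e := (Fintype.equivFin κ).symm
  refine ⟨P, isUnits_det_units P, d ∘ e, hdlin.comp e e.injective, fun k => ?_⟩
  rw [← coe_units_inv]
  exact (isLogarithmic_lin_iff hf).mpr ((hd (e k)).symm ▸ hmem (e k) :)

theorem exists_isGreatest_diagonalRanks [NeZero n] (hf : IsReducedEquation f)
    (hδ : IsLogBasis f Set.univ fun i => lin (δ i)) :
    ∃ s, IsGreatest (diagonalRanks f) (s + 1) := by
  have hone : 1 ∈ diagonalRanks f := by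
    refine ⟨1, by simp, fun _ => 1, LinearIndependent.of_subsingleton 0 one_ne_zero, fun _ => ?_⟩
    rw [isLogarithmic_lin_iff hf]
    simpa using one_mem_tangentMatrices hf hδ
  have hbdd : BddAbove (diagonalRanks f) := by
    refine ⟨n, ?_⟩
    rintro r ⟨P, -, d, hd, -⟩
    simpa using hd.fintype_card_le_finrank
  obtain ⟨s, hs⟩ := Nat.exists_eq_add_of_le' (le_csSup hbdd hone)
  exact ⟨s, hs ▸ ⟨Nat.sSup_mem ⟨1, hone⟩ hbdd, fun r hr => le_csSup hbdd hr⟩⟩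

/-- The fields `σ` complete the Euler field to a basis of a maximal torus of the Lie algebra of
logarithmic vector fields of degree `0`. They are normalized so as to annihilate `Δ` and to have
rational eigenvalues; maximality is expressed through `diagonalRanks`. -/
structure IsRationalTorus (f : (Fin n → ℂ) → ℂ) (δ : Fin n → Matrix (Fin n) (Fin n) ℂ) {s : ℕ}
    (σ : Fin s → Matrix (Fin n) (Fin n) ℂ) : Prop where
  exists_eq_diagConj : ∃ (P : (Matrix (Fin n) (Fin n) ℂ)ˣ) (w : Fin s → Fin n → ℚ),
    ∀ i, σ i = diagConj P fun k => (w i k : ℂ)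
  linearIndependent : LinearIndependent ℂ (Sum.elim (fun _ : Unit => 1) σ)
  linDer_eq_zero : ∀ i, linDer (σ i) (discrPoly δ) = 0
  isGreatest : IsGreatest (diagonalRanks f) (s + 1)

theorem exists_linearIndependent_span_eq_diagonal_tangentMatrices [NeZero n]
    (hf : IsReducedEquation f) (hδ : IsLogBasis f Set.univ fun i => lin (δ i))
    (P : (Matrix (Fin n) (Fin n) ℂ)ˣ) :
    ∃ (r : ℕ) (w : Fin r → Fin n → ℚ),
      (∀ i, linDer (diagConj P fun k => (w i k : ℂ)) (discrPoly δ) = 0) ∧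
      LinearIndependent ℂ (Sum.elim (fun _ : Unit => 1) fun i k => (w i k : ℂ)) ∧
      ∀ d : Fin n → ℂ, diagConj P d ∈ tangentMatrices f →
        d ∈ Submodule.span ℂ (Set.range (Sum.elim (fun _ : Unit => 1) fun i k => (w i k : ℂ))) := by
  obtain ⟨r, w, hw, hker⟩ := exists_linearIndependent_span_eq_linDer_ker (K := ℚ) P (discrPoly δ)
  simp only [eq_ratCast] at hw hker
  refine ⟨r, w, fun i => (hker _).mp (Submodule.subset_span ⟨i, rfl⟩), ?_, fun d hd => ?_⟩
  · refine (LinearIndependent.of_subsingleton () one_ne_zero).sum_type hw ?_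
    rw [Set.range_const, disjoint_comm, Submodule.disjoint_span_singleton' one_ne_zero, hker,
      map_one, ← one_smul ℂ (1 : Matrix (Fin n) (Fin n) ℂ),
      linDer_smul_one_discrPoly_eq_zero_iff hf hδ]
    exact one_ne_zero
  · obtain ⟨c, hc⟩ := exists_linDer_sub_smul_one_eq_zero hf hδ hd
    rw [← map_one (diagConj P), ← map_smul, ← map_sub, ← hker] at hc
    rw [Set.Sum.elim_range, Set.range_const, Set.singleton_union, Submodule.mem_span_insert]
    exact ⟨c, _, hc, (add_sub_cancel _ _).symm⟩

theorem exists_isRationalTorus [NeZero n] (hf : IsReducedEquation f)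
    (hδ : IsLogBasis f Set.univ fun i => lin (δ i)) :
    ∃ (s : ℕ) (σ : Fin s → Matrix (Fin n) (Fin n) ℂ), IsRationalTorus f δ σ := by
  obtain ⟨s, hs⟩ := exists_isGreatest_diagonalRanks hf hδ
  obtain ⟨P, hP, d, hd, hdL⟩ := hs.1
  obtain ⟨P, rfl⟩ := (Matrix.isUnit_iff_isUnit_det P).mpr hP
  obtain ⟨r, w, hker, hW, hspan⟩ :=
    exists_linearIndependent_span_eq_diagonal_tangentMatrices hf hδ P
  set W : Unit ⊕ Fin r → Fin n → ℂ := Sum.elim (fun _ => 1) fun i k => (w i k : ℂ) with hWdef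
  have hσ : LinearIndependent ℂ (diagConj P ∘ W) :=
    hW.map' (diagConj P).toLinearMap (LinearMap.ker_eq_bot.mpr (diagConj_injective P))
  have hWL (k : Unit ⊕ Fin r) : diagConj P (W k) ∈ tangentMatrices f := by
    rcases k with _ | i
    · simpa only [hWdef, Sum.elim_inl, map_one] using one_mem_tangentMatrices hf hδ
    · exact mem_tangentMatrices_of_linDer_eq_zero hf hδ (hker i)
  have hrs : Fintype.card (Unit ⊕ Fin r) ≤ s + 1 := hs.2 <| card_mem_diagonalRanks hf hσ
    (fun i => isSemisimple_toLin'_diagConj P (W i)) (fun i j => commute_diagConj P (W i) (W j)) hWL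
  have hsr : s + 1 ≤ Fintype.card (Unit ⊕ Fin r) := by
    have hdW : Set.range d ⊆ Submodule.span ℂ (Set.range W) := by
      rintro _ ⟨k, rfl⟩
      refine hspan _ ?_
      rw [diagConj_apply, coe_units_inv]
      exact (isLogarithmic_lin_iff hf).mp (hdL k)
    simpa only [finrank_span_eq_card hd, finrank_span_eq_card hW, Fintype.card_fin] using
      Submodule.finrank_mono (Submodule.span_le.mpr hdW)
  have hcard : r + 1 = s + 1 := by simpa [add_comm] using hrs.antisymm hsr
  obtain rfl : r = s := by omega
  refine ⟨r, fun i => diagConj P fun k => (w i k : ℂ), ⟨P, w, fun _ => rfl⟩, ?_, hker, hs⟩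
  rwa [hWdef, Sum.comp_elim, Function.comp_def, map_one] at hσ

end Torus

section RationalTorus

variable {n s : ℕ} {f : (Fin n → ℂ) → ℂ} {δ : Fin n → Matrix (Fin n) (Fin n) ℂ}
  {σ : Fin s → Matrix (Fin n) (Fin n) ℂ}

namespace IsRationalTorus

theorem mem_tangentMatrices (hf : IsReducedEquation f)
    (hδ : IsLogBasis f Set.univ fun i => lin (δ i)) (hσ : IsRationalTorus f δ σ) (i : Fin s) :
    σ i ∈ tangentMatrices f :=
  mem_tangentMatrices_of_linDer_eq_zero hf hδ (hσ.linDer_eq_zero i)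

theorem commute (hσ : IsRationalTorus f δ σ) (i j : Fin s) : Commute (σ i) (σ j) := by
  obtain ⟨P, w, hw⟩ := hσ.exists_eq_diagConj
  rw [hw, hw]
  exact commute_diagConj P _ _

theorem isSemisimple (hσ : IsRationalTorus f δ σ) (i : Fin s) :
    Module.End.IsSemisimple (toLin' (σ i)) := by
  obtain ⟨P, w, hw⟩ := hσ.exists_eq_diagConj
  rw [hw]
  exact isSemisimple_toLin'_diagConj P _

theorem mem_span_of_commute (hf : IsReducedEquation f)
    (hδ : IsLogBasis f Set.univ fun i => lin (δ i)) (hσ : IsRationalTorus f δ σ)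
    {S : Matrix (Fin n) (Fin n) ℂ} (hS : S ∈ tangentMatrices f)
    (hss : Module.End.IsSemisimple (toLin' S)) (hc : ∀ i, Commute (σ i) S) :
    S ∈ Submodule.span ℂ (insert 1 (Set.range σ)) := by
  by_contra hmem
  rw [← Set.singleton_union, ← Set.range_const (ι := Unit), ← Set.Sum.elim_range] at hmem
  have hrank := card_mem_diagonalRanks hf (hσ.linearIndependent.option hmem)
    (by
      rintro (_ | _ | i)
      exacts [hss, by simp, hσ.isSemisimple i])
    (by
      rintro (_ | _ | i) (_ | _ | j)
      exacts [.refl S, .one_right S, (hc j).symm, .one_left S, .refl 1, .one_left (σ j), hc i,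
        .one_right (σ i), hσ.commute i j])
    (by
      rintro (_ | _ | i)
      exacts [hS, one_mem_tangentMatrices hf hδ, hσ.mem_tangentMatrices hf hδ i])
  simpa [add_comm] using hσ.isGreatest.2 hrank

theorem linDer_eq_zero_of_mem_span (hσ : IsRationalTorus f δ σ) {A : Matrix (Fin n) (Fin n) ℂ}
    (hA : A ∈ Submodule.span ℂ (Set.range σ)) : linDer A (discrPoly δ) = 0 := by
  induction hA using Submodule.span_induction with
  | mem x hx => obtain ⟨i, rfl⟩ := hx; exact hσ.linDer_eq_zero i
  | zero => rw [map_zero, Derivation.zero_apply]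
  | add x y _ _ hx hy => rw [map_add, Derivation.add_apply, hx, hy, add_zero]
  | smul a x _ hx => rw [map_smul, Derivation.smul_apply, hx, smul_zero]

theorem semisimple_mem_span (hf : IsReducedEquation f)
    (hδ : IsLogBasis f Set.univ fun i => lin (δ i)) (hσ : IsRationalTorus f δ σ)
    {A S N : Matrix (Fin n) (Fin n) ℂ} (h : IsJordanDecomposition A S N)
    (hA : A ∈ tangentMatrices f) (hc : ∀ i, ⁅σ i, A⁆ = 0) :
    S ∈ Submodule.span ℂ (insert 1 (Set.range σ)) := by
  obtain ⟨c, hcA⟩ := (mem_tangentMatrices_iff hf hδ).mp hA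
  exact hσ.mem_span_of_commute hf hδ
    ((mem_tangentMatrices_iff hf hδ).mpr ⟨c, h.linDer_semisimple hcA⟩) h.semisimple
    fun i => h.commute_left (commute_iff_lie_eq.mpr (hc i))

theorem semisimple_mem_span_range [NeZero n] (hf : IsReducedEquation f)
    (hδ : IsLogBasis f Set.univ fun i => lin (δ i)) (hσ : IsRationalTorus f δ σ)
    {A S N : Matrix (Fin n) (Fin n) ℂ} (h : IsJordanDecomposition A S N)
    (hA : linDer A (discrPoly δ) = 0) (hc : ∀ i, ⁅σ i, A⁆ = 0) :
    S ∈ Submodule.span ℂ (Set.range σ) := by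
  obtain ⟨c, τ, hτ, rfl⟩ := Submodule.mem_span_insert.mp <|
    hσ.semisimple_mem_span hf hδ h (mem_tangentMatrices_of_linDer_eq_zero hf hδ hA) hc
  have hS : linDer (c • 1 + τ) (discrPoly δ) = 0 := by
    rw [h.linDer_semisimple (hA.trans (zero_smul ℂ _).symm), zero_smul]
  rw [map_add, Derivation.add_apply, hσ.linDer_eq_zero_of_mem_span hτ, add_zero,
    linDer_smul_one_discrPoly_eq_zero_iff hf hδ] at hS
  rwa [hS, zero_smul, zero_add]

end IsRationalTorus

/-- The root vectors of the torus spanned by `σ` and the Euler field: the nilpotent logarithmic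
vector fields of degree `0` that are joint eigenvectors of the torus with rational weights. Weight
zero is allowed. -/
def rootVectors (f : (Fin n → ℂ) → ℂ) (σ : Fin s → Matrix (Fin n) (Fin n) ℂ) :
    Set (Matrix (Fin n) (Fin n) ℂ) :=
  {A | A ∈ tangentMatrices f ∧ IsNilpotent A ∧
    ∃ q : Fin s → ℚ, ∀ i, ⁅σ i, A⁆ = (q i : ℂ) • A}

theorem linDer_eq_zero_of_mem_rootVectors (hf : IsReducedEquation f)
    (hδ : IsLogBasis f Set.univ fun i => lin (δ i)) {A : Matrix (Fin n) (Fin n) ℂ}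
    (hA : A ∈ rootVectors f σ) : linDer A (discrPoly δ) = 0 := by
  obtain ⟨c, hc⟩ := (mem_tangentMatrices_iff hf hδ).mp hA.1
  have h : IsJordanDecomposition A 0 A :=
    ⟨(zero_add A).symm, .zero_left A, by simp, hA.2.1⟩
  exact h.linDer_nilpotent hc

theorem IsRationalTorus.mem_span_of_lie_eq_zero (hf : IsReducedEquation f)
    (hδ : IsLogBasis f Set.univ fun i => lin (δ i)) (hσ : IsRationalTorus f δ σ)
    {A : Matrix (Fin n) (Fin n) ℂ} (hA : A ∈ tangentMatrices f) (hc : ∀ i, ⁅σ i, A⁆ = 0) :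
    A ∈ Submodule.span ℂ (insert 1 (Set.range σ) ∪ rootVectors f σ) := by
  obtain ⟨S, N, h, -⟩ := exists_isJordanDecomposition_forall_commute A
  obtain ⟨c, hcA⟩ := (mem_tangentMatrices_iff hf hδ).mp hA
  have hN : N ∈ rootVectors f σ := by
    refine ⟨mem_tangentMatrices_of_linDer_eq_zero hf hδ (h.linDer_nilpotent hcA), h.nilpotent, 0,
      fun i => ?_⟩
    have hA : Commute (σ i) A := commute_iff_lie_eq.mpr (hc i)
    have hN : Commute (σ i) N := by
      rw [← add_sub_cancel_left S N, ← h.eq_add]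
      exact hA.sub_right (h.commute_left hA)
    simpa using commute_iff_lie_eq.mp hN
  rw [h.eq_add]
  exact Submodule.add_mem _
    (Submodule.span_mono Set.subset_union_left (hσ.semisimple_mem_span hf hδ h hA hc))
    (Submodule.subset_span (Or.inr hN))

theorem IsRationalTorus.mem_rootVectors_of_lie_eq_smul (hσ : IsRationalTorus f δ σ)
    {A : Matrix (Fin n) (Fin n) ℂ} (hA : A ∈ tangentMatrices f) {μ : Fin s → ℂ} (hμ : μ ≠ 0)
    (h : ∀ i, ⁅σ i, A⁆ = μ i • A) : A ∈ rootVectors f σ := by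
  obtain ⟨i, hi⟩ := Function.ne_iff.mp hμ
  refine ⟨hA, isNilpotent_of_lie_eq_smul hi (h i), ?_⟩
  obtain rfl | hA0 := eq_or_ne A 0
  · exact ⟨0, fun i => by simp [Ring.lie_def]⟩
  obtain ⟨P, w, hw⟩ := hσ.exists_eq_diagConj
  have hq (i : Fin s) : ∃ q : ℚ, (q : ℂ) = μ i := by
    obtain ⟨a, b, hab⟩ := exists_sub_eq_of_lie_diagConj_eq_smul hA0 ((hw i) ▸ h i)
    exact ⟨w i a - w i b, by rw [Rat.cast_sub, hab]⟩
  choose q hq using hq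
  exact ⟨q, fun i => by rw [hq, h]⟩

attribute [local instance] LieRing.ofAssociativeRing

theorem IsRationalTorus.tangentMatrices_le_span (hf : IsReducedEquation f)
    (hδ : IsLogBasis f Set.univ fun i => lin (δ i)) (hσ : IsRationalTorus f δ σ) :
    tangentMatrices f ≤ Submodule.span ℂ (insert 1 (Set.range σ) ∪ rootVectors f σ) := by
  have hss (i : Fin s) : (LieAlgebra.ad ℂ _ (σ i)).IsSemisimple := by
    obtain ⟨P, w, hw⟩ := hσ.exists_eq_diagConj
    rw [hw]
    exact isSemisimple_ad_algHom_pi (diagConj P) _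
  refine (le_span_joint_eigenvectors (fun i => LieAlgebra.ad ℂ _ (σ i)) hss
    (fun i j => commute_ad (hσ.commute i j)) _ fun i A hA =>
      lie_mem_tangentMatrices hf (hσ.mem_tangentMatrices hf hδ i) hA).trans
    (Submodule.span_le.mpr ?_)
  rintro A ⟨hA, hμ⟩
  choose μ hμ using hμ
  obtain rfl | hμ0 := eq_or_ne μ 0
  · exact hσ.mem_span_of_lie_eq_zero hf hδ hA fun i => by simpa using hμ i
  · exact Submodule.subset_span (Or.inr (hσ.mem_rootVectors_of_lie_eq_smul hA hμ0 hμ))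

theorem exists_extension_of_span {K V ι : Type*} [Field K] [AddCommGroup V] [Module K V]
    [FiniteDimensional K V] {v : ι → V} (hv : LinearIndependent K v) (T : Set V) :
    ∃ (m : ℕ) (ν : Fin m → V), (∀ j, ν j ∈ T) ∧ LinearIndependent K (Sum.elim v ν) ∧
      Submodule.span K (Set.range (Sum.elim v ν)) = Submodule.span K (Set.range v ∪ T) := by
  obtain ⟨b, hbT, hvb, hspan, hb⟩ := exists_linearIndepOn_id_extension hv.linearIndepOn_id
    (Set.subset_union_left (s := Set.range v) (t := T))
  have : Fintype ↥(b \ Set.range v) := (hb.setFinite.subset Set.sdiff_subset).fintype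
  let e := (Fintype.equivFin ↥(b \ Set.range v)).symm
  have hrange : Set.range (Sum.elim v (Subtype.val ∘ e)) = b := by
    rw [Set.Sum.elim_range, e.surjective.range_comp, Subtype.range_coe, Set.union_sdiff_cancel hvb]
  refine ⟨_, Subtype.val ∘ e, fun j => (hbT (e j).2.1).resolve_left (e j).2.2, ?_, ?_⟩
  · have hinj : Function.Injective (Sum.elim v (Subtype.val ∘ e)) :=
      hv.injective.sumElim (Subtype.val_injective.comp e.injective) fun i j h => (e j).2.2 ⟨i, h⟩
    rwa [← linearIndepOn_id_range_iff hinj, hrange]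
  · rw [hrange]
    exact le_antisymm (Submodule.span_mono hbT) (Submodule.span_le.mpr hspan)

theorem IsRationalTorus.exists_rootVectors (hf : IsReducedEquation f)
    (hδ : IsLogBasis f Set.univ fun i => lin (δ i)) (hσ : IsRationalTorus f δ σ) :
    ∃ (m : ℕ) (ν : Fin m → Matrix (Fin n) (Fin n) ℂ), (∀ j, ν j ∈ rootVectors f σ) ∧
      IsLogBasis f Set.univ fun i => lin (Sum.elim (fun _ : Unit => 1) (Sum.elim σ ν) i) := by
  obtain ⟨m, ν, hν, hlin, hspan⟩ := exists_extension_of_span hσ.linearIndependent (rootVectors f σ)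
  have hassoc : Sum.elim (fun _ : Unit => 1) (Sum.elim σ ν) =
      Sum.elim (Sum.elim (fun _ : Unit => 1) σ) ν ∘ (Equiv.sumAssoc Unit (Fin s) (Fin m)).symm := by
    funext i
    rcases i with _ | _ | _ <;> rfl
  refine ⟨m, ν, hν, hδ.of_span_eq hf ?_ ?_⟩
  · rw [hassoc]
    exact hlin.comp _ (Equiv.injective _)
  · rw [hassoc, (Equiv.surjective _).range_comp, hspan, Set.Sum.elim_range, Set.range_const,
      Set.singleton_union]
    refine le_antisymm (Submodule.span_le.mpr ?_) (hσ.tangentMatrices_le_span hf hδ)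
    rintro A ((rfl | ⟨i, rfl⟩) | hA)
    exacts [one_mem_tangentMatrices hf hδ, hσ.mem_tangentMatrices hf hδ i, hA.1]

end RationalTorus

section Engel

attribute [local instance] LieRing.ofAssociativeRing

theorem exists_ne_zero_forall_lie_eq_zero (K : Type*) {L V : Type*} [CommRing K] [LieRing L]
    [LieAlgebra K L] [AddCommGroup V] [Module K V] [LieRingModule L V] [LieModule K L V]
    [LieModule.IsNilpotent L V] [Nontrivial V] : ∃ y : V, y ≠ 0 ∧ ∀ x : L, ⁅x, y⁆ = 0 := by
  have := LieModule.nontrivial_max_triv_of_isNilpotent K L V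
  obtain ⟨y, hy⟩ := exists_ne (0 : LieModule.maxTrivSubmodule K L V)
  exact ⟨y, Subtype.coe_ne_coe.mpr hy, (LieModule.mem_maxTrivSubmodule K L V y).mp y.2⟩

theorem exists_triangular_pair {K L V : Type*} [Field K] [LieRing L] [LieAlgebra K L]
    [AddCommGroup V] [Module K V] [LieRingModule L V] [LieModule K L V]
    [LieModule.IsNilpotent L V] (hV : 1 < Module.finrank K V) :
    ∃ y₁ y₂ : V, LinearIndependent K ![y₁, y₂] ∧
      ∀ x : L, ⁅x, y₁⁆ = 0 ∧ ∃ c : K, ⁅x, y₂⁆ = c • y₁ := by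
  have : Nontrivial V := Module.nontrivial_of_finrank_pos (zero_lt_one.trans hV)
  obtain ⟨y₁, hy₁, hL₁⟩ := exists_ne_zero_forall_lie_eq_zero K (L := L) (V := V)
  let W : LieSubmodule K L V :=
    { K ∙ y₁ with
      lie_mem := by
        intro x y hy
        obtain ⟨a, rfl⟩ := Submodule.mem_span_singleton.mp hy
        simp [hL₁] }
  have hW (y : V) : y ∈ W ↔ ∃ a : K, a • y₁ = y := Submodule.mem_span_singleton
  have : Nontrivial (V ⧸ W) := by
    refine Submodule.Quotient.nontrivial_iff.mpr fun h => hV.ne' ?_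
    rw [← finrank_top K V, ← h]
    exact finrank_span_singleton hy₁
  have : LieModule.IsNilpotent L (V ⧸ W) := by
    obtain ⟨k, hk⟩ := (LieModule.isNilpotent_iff K L V).mp inferInstance
    exact (LieModule.isNilpotent_quotient_iff K L V W).mpr ⟨k, hk ▸ bot_le⟩
  obtain ⟨z, hz, hLz⟩ := exists_ne_zero_forall_lie_eq_zero K (L := L) (V := V ⧸ W)
  obtain ⟨y₂, rfl⟩ := LieSubmodule.Quotient.surjective_mk' W z
  refine ⟨y₁, y₂, (LinearIndependent.pair_iff' hy₁).mpr fun a ha => hz ?_, fun x =>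
    ⟨hL₁ x, ?_⟩⟩
  · exact (LieSubmodule.Quotient.mk_eq_zero').mpr ((hW y₂).mpr ⟨a, ha⟩)
  · obtain ⟨a, ha⟩ := (hW _).mp (LieSubmodule.Quotient.mk_eq_zero'.mp (hLz x))
    exact ⟨a, ha.symm⟩

/-- The Lie algebra of matrices whose linear vector field annihilates the polynomial `p`. -/
def annihilator {ι R : Type*} [CommRing R] [Fintype ι] [DecidableEq ι] (p : MvPolynomial ι R) :
    LieSubalgebra R (Matrix ι ι R) where
  carrier := {A | linDer A p = 0}
  add_mem' {A B} (hA : linDer A p = 0) (hB : linDer B p = 0) := by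
    simp [hA, hB]
  zero_mem' := by simp
  smul_mem' c A (hA : linDer A p = 0) := by simp [hA]
  lie_mem' {A B} (hA : linDer A p = 0) (hB : linDer B p = 0) := by
    change linDer ⁅A, B⁆ p = 0
    rw [linDer_lie, Derivation.commutator_apply, hA, hB, map_zero, map_zero, sub_zero]

theorem exists_triangular_pair_of_isNilpotent {K ι : Type*} [Field K] [Fintype ι] [DecidableEq ι]
    (hι : 1 < Fintype.card ι) (G : LieSubalgebra K (Matrix ι ι K))
    (hG : ∀ A ∈ G, IsNilpotent A) :
    ∃ y₁ y₂ : ι → K, LinearIndependent K ![y₁, y₂] ∧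
      ∀ A ∈ G, A *ᵥ y₁ = 0 ∧ ∃ c : K, A *ᵥ y₂ = c • y₁ := by
  let H : LieSubalgebra K (Module.End K (ι → K)) := G.comap lieEquivMatrix'.toLieHom
  have : LieModule.IsNilpotent H (ι → K) := by
    refine (LieModule.isNilpotent_iff_forall (R := K)).mpr fun φ => ?_
    have hφ : IsNilpotent (toLinAlgEquiv' (LinearMap.toMatrixAlgEquiv' φ.1)) :=
      IsNilpotent.map (hG _ φ.2) _
    rwa [toLinAlgEquiv'_toMatrixAlgEquiv'] at hφ
  obtain ⟨y₁, y₂, hy, hH⟩ := exists_triangular_pair (K := K) (L := H) (V := ι → K) (by simpa)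
  refine ⟨y₁, y₂, hy, fun A hA => ?_⟩
  have hmem : toLin' A ∈ H := by
    change LinearMap.toMatrix' (toLin' A) ∈ G
    rwa [LinearMap.toMatrix'_toLin']
  exact hH ⟨toLin' A, hmem⟩

variable {n s : ℕ} {f : (Fin n → ℂ) → ℂ} {δ : Fin n → Matrix (Fin n) (Fin n) ℂ}

theorem IsRationalTorus.isNilpotent_of_linDer_eq_zero [NeZero n] (hf : IsReducedEquation f)
    (hδ : IsLogBasis f Set.univ fun i => lin (δ i)) {σ : Fin 0 → Matrix (Fin n) (Fin n) ℂ}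
    (hσ : IsRationalTorus f δ σ) {A : Matrix (Fin n) (Fin n) ℂ}
    (hA : linDer A (discrPoly δ) = 0) : IsNilpotent A := by
  obtain ⟨S, N, h, -⟩ := exists_isJordanDecomposition_forall_commute A
  have hS := hσ.semisimple_mem_span_range hf hδ h hA fun i => i.elim0
  rw [Set.range_eq_empty, Submodule.span_empty, Submodule.mem_bot] at hS
  rw [h.eq_add, hS, zero_add]
  exact h.nilpotent

theorem IsRationalTorus.one_le (hn : 2 ≤ n) (hf : IsReducedEquation f)
    (hδ : IsLogBasis f Set.univ fun i => lin (δ i)) {σ : Fin s → Matrix (Fin n) (Fin n) ℂ}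
    (hσ : IsRationalTorus f δ σ) : 1 ≤ s := by
  have : NeZero n := ⟨by omega⟩
  obtain ⟨m, ν, hν, hb⟩ := hσ.exists_rootVectors hf hδ
  by_contra! hs
  obtain rfl : s = 0 := Nat.lt_one_iff.mp hs
  obtain ⟨y₁, y₂, hy, hG⟩ := exists_triangular_pair_of_isNilpotent (by rwa [Fintype.card_fin])
    (annihilator (discrPoly δ)) fun A hA => hσ.isNilpotent_of_linDer_eq_zero hf hδ hA
  have hk (k : Fin 0 ⊕ Fin m) : Sum.elim σ ν k ∈ annihilator (discrPoly δ) := by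
    rcases k with i | j
    · exact i.elim0
    · exact linDer_eq_zero_of_mem_rootVectors hf hδ (hν j)
  exact not_isLogBasis_of_triangular hf hy (fun k => (hG _ (hk k)).1) (fun k => (hG _ (hk k)).2) hb

end Engel

section NormalCrossing

variable {n : ℕ} {f : (Fin n → ℂ) → ℂ} {δ : Fin n → Matrix (Fin n) (Fin n) ℂ}

theorem discr_diagConj (P : (Matrix (Fin n) (Fin n) ℂ)ˣ) (d : Fin n → Fin n → ℂ)
    (x : Fin n → ℂ) :
    discr (fun i => diagConj P (d i)) x =
      (of d).det * (↑P⁻¹ : Matrix (Fin n) (Fin n) ℂ).det * ∏ k, lin (P : Matrix _ _ ℂ) x k := by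
  have hmul : (of fun i j => lin (diagConj P (d i)) x j) =
      of d * diagonal (lin (P : Matrix _ _ ℂ) x) * (↑P⁻¹ : Matrix (Fin n) (Fin n) ℂ) := by
    refine Matrix.ext fun i j => ?_
    simp only [of_apply, diagConj_apply, lin, ← vecMul_vecMul]
    rw [mul_apply, vecMul, dotProduct]
    refine Finset.sum_congr rfl fun k _ => ?_
    rw [vecMul_diagonal, mul_diagonal, of_apply, mul_comm (d i k)]
  rw [discr, hmul, det_mul, det_mul, det_diagonal]
  ring

theorem exists_lin_prod_eq_mul [NeZero n] {P : Matrix (Fin n) (Fin n) ℂ} (hP : IsUnit P.det)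
    {c : ℂ} (hc : c ≠ 0) :
    ∃ Q : Matrix (Fin n) (Fin n) ℂ, IsUnit Q.det ∧ ∀ x, ∏ k, lin Q x k = c * ∏ k, lin P x k := by
  let u : Fin n → ℂ := Pi.mulSingle 0 c
  have hu : ∏ k, u k = c := Fintype.prod_pi_mulSingle' _ _
  refine ⟨P * diagonal u, ?_, fun x => ?_⟩
  · rw [det_mul, det_diagonal, hu]
    exact hP.mul hc.isUnit
  · simp only [lin, ← vecMul_vecMul, vecMul_diagonal, Finset.prod_mul_distrib, hu, mul_comm]

theorem exists_discr_eq_prod_of_forall_diagConj_eq [NeZero n] (hf : IsReducedEquation f)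
    (hδ : IsLogBasis f Set.univ fun i => lin (δ i)) {P : (Matrix (Fin n) (Fin n) ℂ)ˣ}
    (hd : ∀ i, ∃ d, diagConj P d = δ i) :
    ∃ Q : Matrix (Fin n) (Fin n) ℂ, IsUnit Q.det ∧ (∀ x, discr δ x = ∏ k, lin Q x k) ∧
      {x | f x = 0} = {x | ∃ k, lin Q x k = 0} := by
  choose d hd using hd
  obtain rfl : (fun i => diagConj P (d i)) = δ := funext hd
  obtain ⟨x, hx⟩ := hf.ne_zero
  have hx0 := discr_ne_zero_of_ne_zero hf hδ hx
  rw [discr_diagConj] at hx0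
  obtain ⟨Q, hQ, hprod⟩ := exists_lin_prod_eq_mul (isUnits_det_units P) (left_ne_zero_of_mul hx0)
  have hdiscr (x : Fin n → ℂ) : discr (fun i => diagConj P (d i)) x = ∏ k, lin Q x k := by
    rw [hprod, discr_diagConj]
  refine ⟨Q, hQ, hdiscr, Set.ext fun x => ?_⟩
  rw [Set.mem_ofPred_eq, eq_zero_iff_discr_eq_zero hf hδ, hdiscr, Finset.prod_eq_zero_iff]
  simp

end NormalCrossing

section Basis

variable {n s m : ℕ} {f : (Fin n → ℂ) → ℂ} {δ : Fin n → Matrix (Fin n) (Fin n) ℂ}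
  {σ : Fin s → Matrix (Fin n) (Fin n) ℂ} {ν : Fin m → Matrix (Fin n) (Fin n) ℂ}

theorem IsLogBasis.one_add_add_eq (hf : IsReducedEquation f)
    (hb : IsLogBasis f Set.univ fun i => lin (Sum.elim (fun _ : Unit => 1) (Sum.elim σ ν) i))
    (hδ : IsLogBasis f Set.univ fun i => lin (δ i)) :
    1 + s + m = n := by
  simpa [add_assoc] using hb.card_eq hf hδ

namespace IsRationalTorus

theorem exists_eq_mul_diagonal_mul_inv (hσ : IsRationalTorus f δ σ) :
    ∃ P : Matrix (Fin n) (Fin n) ℂ, IsUnit P.det ∧ ∃ w : Fin s → Fin n → ℚ,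
      ∀ i, σ i = P * diagonal (fun k => (w i k : ℂ)) * P⁻¹ := by
  obtain ⟨P, w, hw⟩ := hσ.exists_eq_diagConj
  exact ⟨P, isUnits_det_units P, w, fun i => by rw [hw, diagConj_apply, coe_units_inv]⟩

theorem sum_weights_add_trace_eq_zero (hf : IsReducedEquation f)
    (hδ : IsLogBasis f Set.univ fun i => lin (δ i)) (hσ : IsRationalTorus f δ σ)
    (hb : IsLogBasis f Set.univ fun i => lin (Sum.elim (fun _ : Unit => 1) (Sum.elim σ ν) i))
    (i : Fin s) {q : Fin m → ℂ} (hq : ∀ j, ⁅σ i, ν j⁆ = q j • ν j) :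
    ∑ j, q j + (σ i).trace = 0 := by
  have hc : ∀ k, ⁅σ i, Sum.elim (fun _ : Unit => 1) (Sum.elim σ ν) k⁆ =
      Sum.elim (fun _ : Unit => (0 : ℂ)) (Sum.elim (fun _ : Fin s => 0) q) k •
        Sum.elim (fun _ : Unit => 1) (Sum.elim σ ν) k := by
    rintro (_ | i' | j)
    · simp [Ring.lie_def]
    · simpa using commute_iff_lie_eq.mp (hσ.commute i i')
    · exact hq j
  simpa using sum_add_trace_eq_zero_of_lie_eq_smul hf hδ hb (hσ.linDer_eq_zero i) hc

theorem exists_discr_eq_prod [NeZero n] (hf : IsReducedEquation f)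
    (hδ : IsLogBasis f Set.univ fun i => lin (δ i)) (hσ : IsRationalTorus f δ σ)
    (hs : s = n - 1) :
    ∃ P : Matrix (Fin n) (Fin n) ℂ, IsUnit P.det ∧ (∀ x, discr δ x = ∏ k, lin P x k) ∧
      {x | f x = 0} = {x | ∃ k, lin P x k = 0} := by
  obtain ⟨m, ν, -, hb⟩ := hσ.exists_rootVectors hf hδ
  obtain rfl : m = 0 := by have := hb.one_add_add_eq hf hδ; omega
  obtain ⟨P, w, hw⟩ := hσ.exists_eq_diagConj
  have hle : tangentMatrices f ≤ LinearMap.range (diagConj P).toLinearMap := by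
    rw [← hb.span_eq hf, Submodule.span_le]
    rintro _ ⟨_ | i | j, rfl⟩
    · exact ⟨1, map_one (diagConj P)⟩
    · exact ⟨_, (hw i).symm⟩
    · exact j.elim0
  exact exists_discr_eq_prod_of_forall_diagConj_eq hf hδ fun i =>
    hle ((isLogarithmic_lin_iff hf).mp (hδ.1 i))

end IsRationalTorus

end Basis

end LFD

theorem theorem51 {n : ℕ} (hn : 1 ≤ n) (f : (Fin n → ℂ) → ℂ) (hf : LFD.IsLinearFree f)
    (δ : Fin n → Matrix (Fin n) (Fin n) ℂ)
    (hδ : LFD.IsLogBasis f Set.univ (fun i => LFD.lin (δ i))) :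
    ∃ s m : ℕ, 1 + s + m = n ∧ IsGreatest (LFD.diagonalRanks f) (s + 1) ∧
      (∃ (χ : Matrix (Fin n) (Fin n) ℂ) (σ : Fin s → Matrix (Fin n) (Fin n) ℂ)
          (ν : Fin m → Matrix (Fin n) (Fin n) ℂ),
        (∀ x, LFD.lin χ x = x) ∧
        LFD.IsLogBasis f Set.univ
          (Sum.elim (fun _ : Unit => LFD.lin χ)
            (Sum.elim (fun i => LFD.lin (σ i)) (fun j => LFD.lin (ν j)))) ∧
        ((∀ i, ⁅χ, σ i⁆ = 0) ∧ (∀ j, ⁅χ, ν j⁆ = 0)) ∧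
        ((∃ P : Matrix (Fin n) (Fin n) ℂ, IsUnit P.det ∧ ∃ w : Fin s → Fin n → ℚ,
            ∀ i, σ i = P * Matrix.diagonal (fun k => (w i k : ℂ)) * P⁻¹) ∧
          ∀ i x, LFD.act (LFD.lin (σ i)) (LFD.discr δ) x = 0) ∧
        ((∀ j, IsNilpotent (ν j)) ∧ ∀ j x, LFD.act (LFD.lin (ν j)) (LFD.discr δ) x = 0) ∧
        (∃ q : Fin s → Fin m → ℚ, (∀ i j, ⁅σ i, ν j⁆ = (q i j : ℂ) • ν j) ∧
          ∀ i, (∑ j, (q i j : ℂ)) + (σ i).trace = 0) ∧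
        (∀ A S N : Matrix (Fin n) (Fin n) ℂ, LFD.IsLogarithmic f Set.univ (LFD.lin A) →
          (∀ i, ⁅σ i, A⁆ = 0) → LFD.IsJordanDecomposition A S N →
            S ∈ Submodule.span ℂ (insert χ (Set.range σ)) ∧
            ((∀ x, LFD.act (LFD.lin A) (LFD.discr δ) x = 0) →
              S ∈ Submodule.span ℂ (Set.range σ)))) ∧
      (2 ≤ n → 1 ≤ s) ∧
      (s = n - 1 → ∃ P : Matrix (Fin n) (Fin n) ℂ, IsUnit P.det ∧
        (∀ x, LFD.discr δ x = ∏ k, LFD.lin P x k) ∧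
        {x | f x = 0} = {x | ∃ k, LFD.lin P x k = 0}) := by
  obtain ⟨hf, -, -⟩ := hf
  have : NeZero n := ⟨by omega⟩
  obtain ⟨s, σ, hσ⟩ := LFD.exists_isRationalTorus hf hδ
  obtain ⟨m, ν, hν, hb⟩ := hσ.exists_rootVectors hf hδ
  choose hνL hνn q hq using hν
  refine ⟨s, m, hb.one_add_add_eq hf hδ, hσ.isGreatest, ⟨1, σ, ν, LFD.lin_one,
    ?_, ⟨fun i => ?_, fun j => ?_⟩, ⟨hσ.exists_eq_mul_diagonal_mul_inv, fun i => ?_⟩,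
    ⟨hνn, fun j => ?_⟩, ⟨fun i j => q j i, fun i j => hq j i, fun i => ?_⟩,
    fun A S N hA hc h => ⟨?_, fun hA0 => ?_⟩⟩, fun h2 => hσ.one_le h2 hf hδ,
    hσ.exists_discr_eq_prod hf hδ⟩
  · convert hb with x
    rcases x with _ | i | j <;> rfl
  · exact commute_iff_lie_eq.mp (.one_left (σ i))
  · exact commute_iff_lie_eq.mp (.one_left (ν j))
  · exact (LFD.act_lin_discr_eq_zero_iff δ (σ i)).mpr (hσ.linDer_eq_zero i)
  · exact (LFD.act_lin_discr_eq_zero_iff δ (ν j)).mpr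
      (LFD.linDer_eq_zero_of_mem_rootVectors hf hδ ⟨hνL j, hνn j, q j, hq j⟩)
  · exact hσ.sum_weights_add_trace_eq_zero hf hδ hb i fun j => hq j i
  · exact hσ.semisimple_mem_span hf hδ h ((LFD.isLogarithmic_lin_iff hf).mp hA) hc
  · exact hσ.semisimple_mem_span_range hf hδ h ((LFD.act_lin_discr_eq_zero_iff δ A).mp hA0) hc
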